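/- A frequency is a strictly increasing sequence $\lambda=(\lambda_n)$ of nonnegative real numbers tending to $+\infty$. A $\lambda$-Dirichlet group is a pair $(G,\beta)$ where $G$ is a compact (Hausdorff) abelian group and $\beta:(\mathbb R,+)\to G$ is a continuous homomorphism with dense range such that for every $n$ there is a (necessarily unique) character $h_{\lambda_n}\in\widehat G$ with $h_{\lambda_n}(\beta(t))=e^{-i\lambda_n t}$ for all $t\in\mathbb R$. Equip $G$ with its normalized Haar measure $m$, write $\widehat f(\chi)=\int_G f\,\overline{\chi}\,dm$, and let $H_1^\lambda(G)$ be the subspace of those $f\in L_1(G)$ with $\widehat f(\chi)=0$ for all $\chi\in\widehat G\setminus\{h_{\lambda_n}: n\}$, with the $L_1$ norm. For $\psi\in L_1(\mathbb R)$ put $\widehat\psi(\xi)=\int_{\mathbb R}\psi(t)e^{-it\xi}\,dt$ and, when $\widehat\psi$ has compact support, $$R_\psi(f)=\sum_n \widehat f(h_{\lambda_n})\,\widehat\psi(\lambda_n)\,h_{\lambda_n}\qquad(f\in H_1^\lambda(G)),$$ which is a finite sum. **Theorem.** Let $\lambda$ be a frequency and $(G,\beta)$ a $\lambda$-Dirichlet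 group. Let $\psi\in L_1(\mathbb R)$ be complex-valued and continuous except at finitely many points, such that $\widehat\psi$ has compact support and there is a nonincreasing function $g\in L_1(0,+\infty)$ with $|\psi(x)|\le g(|x|)$ for all $x\neq 0$. For real $N\ge 1$ let $\psi_N(x)=N\psi(Nx)$. Then $$R_{\max,\psi}(f):=\sup_{N\ge 1}|R_{\psi_N}(f)|$$ defines a bounded sublinear operator from $H_1^\lambda(G)$ into $L_{1,\infty}(G)$: for all $f,g\in H_1^\lambda(G)$ and $c\in\mathbb C$, $R_{\max,\psi}(f)$ is a measurable $[0,\infty]$-valued function, $R_{\max,\psi}(f+g)\le R_{\max,\psi}(f)+R_{\max,\psi}(g)$, $R_{\max,\psi}(cf)=|c|\,R_{\max,\psi}(f)$, and there is a constant $C<\infty$ such that for all $f\in H_1^\lambda(G)$ $$\sup_{t>0}\ t\,m\big(\{\omega\in G: R_{\max,\psi}(f)(\omega)>t\}\big)\le C\,\|f\|_1 .$$ Moreover, if $\int_{\mathbb R}\psi=1$, then for every $f\in H_1^\lambda(G)$ and almost every $\omega\in G$, $R_{\psi_N}(f)(\omega)\to f(\omega)$ as $N\to+\infty$. -/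

import Mathlib

open MeasureTheory Filter Topology
open scoped NNReal ENNReal

noncomputable section

namespace GenDirichlet

/-- A frequency: a (strictly) increasing sequence of nonnegative reals tending to `+∞`. -/
structure IsFrequency (lam : ℕ → ℝ) : Prop where
  strictMono : StrictMono lam
  nonneg : ∀ n, 0 ≤ lam n
  tendsto_atTop : Tendsto lam atTop atTop

/-- A `lam`-Dirichlet group structure on a compact abelian group `G`: a continuous homomorphism
`β : (ℝ, +) → G` with dense range such that, for each `n`, there is a character `h_{λ_n}` of `G`
with `h_{λ_n} ∘ β = e^{-i λ_n ·}`. By density of the range, that character is unique; it is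
recorded as `char n`. -/
structure DirichletGroup (lam : ℕ → ℝ) (G : Type*) [CommGroup G] [TopologicalSpace G] where
  β : Multiplicative ℝ →ₜ* G
  denseRange : DenseRange β
  char : ℕ → PontryaginDual G
  char_comp : ∀ (n : ℕ) (t : ℝ),
    ((char n (β (Multiplicative.ofAdd t)) : Circle) : ℂ) =
      Complex.exp (-Complex.I * (lam n : ℂ) * (t : ℂ))

/-- The Fourier transform on the line, normalized as `ψ̂(ξ) = ∫ ψ(t) e^{-i t ξ} dt`. -/
def lineFourier (ψ : ℝ → ℂ) (ξ : ℝ) : ℂ :=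
  ∫ t : ℝ, ψ t * Complex.exp (-Complex.I * (t : ℂ) * (ξ : ℂ))

/-- The `L¹`-normalized dilation `ψ_N(x) = N ψ(N x)`, so that `ψ̂_N(ξ) = ψ̂(ξ / N)`. -/
def dilate (ψ : ℝ → ℂ) (N : ℝ) (x : ℝ) : ℂ := (N : ℂ) * ψ (N * x)

section Group

variable {G : Type*} [CommGroup G] [TopologicalSpace G] [MeasurableSpace G]

/-- The Fourier coefficient `f̂(χ) = ∫_G f(ω) conj (χ(ω)) dω`. -/
def groupFourier (μ : Measure G) (f : G → ℂ) (χ : PontryaginDual G) : ℂ :=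
  ∫ ω, f ω * (starRingEnd ℂ) ((χ ω : Circle) : ℂ) ∂μ

theorem integrable_mul_conj_char [BorelSpace G] (μ : Measure G) (f : Lp ℂ 1 μ)
    (χ : PontryaginDual G) :
    Integrable (fun ω => f ω * (starRingEnd ℂ) ((χ ω : Circle) : ℂ)) μ := by
  have hc : Continuous fun ω : G => (starRingEnd ℂ) ((χ ω : Circle) : ℂ) :=
    Complex.continuous_conj.comp (continuous_subtype_val.comp (map_continuous χ))
  have hf : Integrable (fun ω => f ω) μ := L1.integrable_coeFn f
  refine hf.mul_bdd (c := 1) hc.aestronglyMeasurable ?_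
  exact Eventually.of_forall fun ω => by rw [RCLike.norm_conj]; exact (Circle.norm_coe _).le

theorem groupFourier_add [BorelSpace G] (μ : Measure G) (f g : Lp ℂ 1 μ)
    (χ : PontryaginDual G) :
    groupFourier μ (f + g : Lp ℂ 1 μ) χ = groupFourier μ f χ + groupFourier μ g χ := by
  unfold groupFourier
  rw [← integral_add (integrable_mul_conj_char μ f χ) (integrable_mul_conj_char μ g χ)]
  refine integral_congr_ae ?_
  filter_upwards [Lp.coeFn_add f g] with ω h
  rw [h, Pi.add_apply, add_mul]

theorem groupFourier_smul (μ : Measure G) (c : ℂ) (f : Lp ℂ 1 μ) (χ : PontryaginDual G) :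
    groupFourier μ (c • f : Lp ℂ 1 μ) χ = c * groupFourier μ f χ := by
  unfold groupFourier
  rw [← integral_const_mul]
  refine integral_congr_ae ?_
  filter_upwards [Lp.coeFn_smul c f] with ω h
  rw [h, Pi.smul_apply, smul_eq_mul, mul_assoc]

/-- The Hardy space `H_1^λ(G)`: the subspace of the `f ∈ L¹(G)`, with the `L¹` norm, whose Fourier
transform is supported on `{h_{λ_n} : n ∈ ℕ}`. -/
def hardyOne {lam : ℕ → ℝ} [BorelSpace G] (D : DirichletGroup lam G) (μ : Measure G) :
    Submodule ℂ (Lp ℂ 1 μ) where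
  carrier := {f | ∀ χ : PontryaginDual G, χ ∉ Set.range D.char → groupFourier μ f χ = 0}
  add_mem' := by
    intro f g hf hg χ hχ
    rw [groupFourier_add, hf χ hχ, hg χ hχ, add_zero]
  zero_mem' := by
    intro χ _
    have h := groupFourier_smul μ 0 (0 : Lp ℂ 1 μ) χ
    rwa [zero_smul, zero_mul] at h
  smul_mem' := by
    intro c f hf χ hχ
    rw [groupFourier_smul, hf χ hχ, mul_zero]

/-- `R_ψ(f) = ∑_n f̂(h_{λ_n}) ψ̂(λ_n) h_{λ_n}`, a finite sum when `ψ̂` has compact support. -/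
def mollify {lam : ℕ → ℝ} (D : DirichletGroup lam G) (μ : Measure G) (ψ : ℝ → ℂ) (f : G → ℂ)
    (ω : G) : ℂ :=
  ∑' n : ℕ, groupFourier μ f (D.char n) * lineFourier ψ (lam n) * ((D.char n ω : Circle) : ℂ)

/-- The maximal function `R_{max,ψ}(f) = sup_{N ≥ 1} |R_{ψ_N}(f)|`, with values in `[0, ∞]`,
the supremum running over all real `N ≥ 1`. -/
def maximalMollify {lam : ℕ → ℝ} (D : DirichletGroup lam G) (μ : Measure G) (ψ : ℝ → ℂ)
    (f : G → ℂ) (ω : G) : ℝ≥0∞ :=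
  ⨆ N : Set.Ici (1 : ℝ), ‖mollify D μ (dilate ψ N) f ω‖ₑ

/-- The weak `L¹` quasi-norm `sup_{t > 0} t · μ {F > t}` of a nonnegative function. -/
def weakL1Norm (μ : Measure G) (F : G → ℝ≥0∞) : ℝ≥0∞ :=
  ⨆ t : ℝ≥0, (t : ℝ≥0∞) * μ {ω | (t : ℝ≥0∞) < F ω}

end Group

end GenDirichlet

end

/-! The idea is to replace Fourier multipliers on `G` by convolution along the flow `ω ↦ ω β(t)`.
Since `h_{λ_n}(β(t)) = e^{-iλ_n t}`, the function `∫ ψ_N(t) f(ω β(t)) dt` has Fourier coefficient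
`f̂(h_{λ_n}) ψ̂(λ_n / N)` at `h_{λ_n}`, and, for `f` in the Hardy space, coefficient zero at all
other characters. These are the coefficients of `R_{ψ_N}(f)`, so the two agree almost everywhere
(`flowConv_ae_eq_mollify`). The map `N ↦ R_{ψ_N}(f)(ω)` is continuous, so countably many `N` suffice
for the supremum and the exceptional null sets can be united.

The decreasing majorant `g` bounds these convolutions, uniformly in `N`, by `4‖g‖₁` times the dyadic
maximal average of `|f|` along the orbit (`lintegral_mul_radial_le`). That maximal average is of
weak type (1,1) on `G`: Vitali's covering lemma gives a local estimate on the line, which is applied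
on each orbit and integrated over `G`, the flow being measure preserving
(`mul_measure_lt_dyadicMax_flow_le`).

For convergence, the band-limited functions obtained by convolving `f` with `ψ_j` tend to `f` in
`L¹`. On each of them `R_{ψ_N}` is a fixed finite sum whose coefficients converge because `ψ̂` is
continuous with `ψ̂(0) = 1`. The weak type inequality controls the remainder.

Uniqueness of Fourier coefficients and density of trigonometric polynomials rest on the characters
separating points. This is proved from the spectral theorem: compact operators commuting with
translations yield finite-dimensional eigenspaces, hence common eigenvectors of translations, and
these are multiples of characters. -/

noncomputable section

/-! ### Common eigenvectors of translations on `L²(G)` -/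

/-- A commuting family of endomorphisms of a nonzero finite-dimensional complex vector space has a
common eigenvector. -/
theorem Module.End.exists_common_eigenvector {ι : Type*} (n : ℕ) :
    ∀ {E : Type*} [AddCommGroup E] [Module ℂ E] [FiniteDimensional ℂ E] [Nontrivial E]
      (f : ι → Module.End ℂ E), (∀ i j, Commute (f i) (f j)) → Module.finrank ℂ E = n →
      ∃ v : E, v ≠ 0 ∧ ∀ i, ∃ c : ℂ, f i v = c • v := by
  induction n using Nat.strong_induction_on with
  | _ n ih =>
    intro E _ _ _ _ f hf hn
    by_cases h : ∀ i, ∃ c : ℂ, ∀ v, f i v = c • v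
    · obtain ⟨v, hv⟩ := exists_ne (0 : E)
      exact ⟨v, hv, fun i => (h i).imp fun c hc => hc v⟩
    -- A non-scalar member has a proper nonzero eigenspace, which the whole family preserves by
    -- commutation; the induction descends to it.
    · push Not at h
      obtain ⟨i, hi⟩ := h
      obtain ⟨c, hc⟩ := Module.End.exists_eigenvalue (f i)
      set E' := Module.End.eigenspace (f i) c with hE'
      have hmap : ∀ j, ∀ v ∈ E', f j v ∈ E' := by
        intro j v hv
        rw [Module.End.mem_eigenspace_iff] at hv ⊢
        have := LinearMap.congr_fun (hf i j).eq v
        simp only [Module.End.mul_apply] at this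
        rw [this, hv, map_smul]
      have hlt : Module.finrank ℂ E' < n := by
        rw [← hn]
        refine Submodule.finrank_lt (lt_top_iff_ne_top.2 fun htop => ?_).ne
        obtain ⟨v, hv⟩ := hi c
        exact hv (Module.End.mem_eigenspace_iff.1 (htop ▸ Submodule.mem_top : v ∈ E'))
      have : Nontrivial E' := Submodule.nontrivial_iff_ne_bot.2 hc
      obtain ⟨v, hv, hv'⟩ := ih _ hlt (fun j => (f j).restrict (hmap j)) (fun j k => by
        ext v
        exact LinearMap.congr_fun (hf j k).eq v.1) rfl
      refine ⟨v, by simpa using hv, fun j => (hv' j).imp fun d hd => ?_⟩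
      simpa using congrArg Subtype.val hd

section Compact

variable {G : Type*} [CommGroup G] [TopologicalSpace G] [IsTopologicalGroup G] [CompactSpace G]
    [MeasurableSpace G] [BorelSpace G] (μ : Measure G) [μ.IsHaarMeasure]

/-- Translation on `L²(G)`. -/
def translateL2 (x : G) : Lp ℂ 2 μ →ₗᵢ[ℂ] Lp ℂ 2 μ :=
  Lp.compMeasurePreservingₗᵢ ℂ (x * ·) (measurePreserving_mul_left μ x)

omit [CompactSpace G] in
theorem coeFn_translateL2 (x : G) (f : Lp ℂ 2 μ) :
    translateL2 μ x f =ᵐ[μ] fun ω => f (x * ω) :=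
  Lp.coeFn_compMeasurePreserving f (measurePreserving_mul_left μ x)

omit [CompactSpace G] in
theorem translateL2_mul (x y : G) (f : Lp ℂ 2 μ) :
    translateL2 μ (x * y) f = translateL2 μ x (translateL2 μ y f) := by
  refine Lp.ext ?_
  have h := (measurePreserving_mul_left μ x).quasiMeasurePreserving.ae (coeFn_translateL2 μ y f)
  filter_upwards [coeFn_translateL2 μ (x * y) f, coeFn_translateL2 μ x (translateL2 μ y f), h]
    with ω h1 h2 h3
  rw [h1, h2, h3, mul_comm x y, mul_assoc]

omit [CompactSpace G] in
theorem translateL2_comm (x y : G) (f : Lp ℂ 2 μ) :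
    translateL2 μ x (translateL2 μ y f) = translateL2 μ y (translateL2 μ x f) := by
  rw [← translateL2_mul, ← translateL2_mul, mul_comm]

omit [CompactSpace G] in
theorem translateL2_one (f : Lp ℂ 2 μ) : translateL2 μ 1 f = f := by
  refine Lp.ext ?_
  filter_upwards [coeFn_translateL2 μ 1 f] with ω h1
  rw [h1, one_mul]

omit [CompactSpace G] in
theorem inner_translateL2_left (x : G) (f g : Lp ℂ 2 μ) :
    inner ℂ (translateL2 μ x f) g = inner ℂ f (translateL2 μ x⁻¹ g) := by
  rw [← (translateL2 μ x).inner_map_map f, ← translateL2_mul, mul_inv_cancel, translateL2_one]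

omit [CompactSpace G] in
theorem inner_translateL2_right (x : G) (f g : Lp ℂ 2 μ) :
    inner ℂ f (translateL2 μ x g) = inner ℂ (translateL2 μ x⁻¹ f) g := by
  rw [inner_translateL2_left, inv_inv]

theorem continuous_translateL2 (f : Lp ℂ 2 μ) : Continuous fun x => translateL2 μ x f := by
  have hc : Continuous fun p : G × G => p.1 * p.2 := continuous_mul
  exact Continuous.compMeasurePreservingLp (f := fun _ => f)
    (g := (⟨fun p : G × G => p.1 * p.2, hc⟩ : C(G × G, G)).curry) continuous_const
    (ContinuousMap.continuous _) (fun x => measurePreserving_mul_left μ x) (by norm_num)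

/-- The operator `f ↦ (x ↦ ⟪K, f(x ·)⟫)` from `L²(G)` to the bounded continuous functions. -/
def correlation (K : Lp ℂ 2 μ) : Lp ℂ 2 μ →L[ℂ] BoundedContinuousFunction G ℂ :=
  LinearMap.mkContinuous
    { toFun := fun f => BoundedContinuousFunction.mkOfCompact
        ⟨fun x => inner ℂ K (translateL2 μ x f),
          continuous_const.inner (continuous_translateL2 μ f)⟩
      map_add' := fun f g => by ext x; simp [inner_add_right]
      map_smul' := fun c f => by ext x; simp [inner_smul_right] } ‖K‖ (fun f => by
    refine (BoundedContinuousFunction.norm_le (by positivity)).2 fun x => ?_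
    refine (norm_inner_le_norm (𝕜 := ℂ) K (translateL2 μ x f)).trans ?_
    rw [LinearIsometry.norm_map])

/-- Arzelà–Ascoli: moving the translation onto `K` and using Cauchy–Schwarz, the oscillation between
`x` and `y` is at most `‖K(x⁻¹ ·) - K(y⁻¹ ·)‖ ‖f‖`, which gives equicontinuity over the unit ball.
-/
theorem isCompactOperator_correlation (K : Lp ℂ 2 μ) : IsCompactOperator (correlation μ K) := by
  refine (isCompactOperator_iff_isCompact_closure_image_closedBall
    (correlation μ K).toLinearMap one_pos).2 ?_
  refine BoundedContinuousFunction.arzela_ascoli (Metric.closedBall (0 : ℂ) ‖K‖)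
    (isCompact_closedBall _ _) _ ?_ ?_
  · rintro _ x ⟨f, hf, rfl⟩
    rw [mem_closedBall_zero_iff] at hf ⊢
    refine (norm_inner_le_norm (𝕜 := ℂ) K (translateL2 μ x f)).trans ?_
    rw [LinearIsometry.norm_map]
    exact mul_le_of_le_one_right (norm_nonneg _) hf
  · intro x
    refine Metric.equicontinuousAt_iff_right.2 fun ε hε => ?_
    have hc : Continuous fun x : G => translateL2 μ x⁻¹ K :=
      (continuous_translateL2 μ K).comp continuous_inv
    filter_upwards [Metric.continuousAt_iff'.1 (hc.continuousAt (x := x)) ε hε] with y hy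
    rintro ⟨_, f, hf, rfl⟩
    rw [mem_closedBall_zero_iff] at hf
    change dist (inner ℂ K (translateL2 μ x f)) (inner ℂ K (translateL2 μ y f)) < ε
    rw [inner_translateL2_right, inner_translateL2_right, dist_comm, dist_eq_norm,
      ← inner_sub_left]
    refine (norm_inner_le_norm _ _).trans_lt ?_
    rw [dist_eq_norm] at hy
    exact (mul_le_of_le_one_right (norm_nonneg _) hf).trans_lt hy

/-- The operator `correlation μ K` with values in `L²(G)`. -/
def correlationL2 (K : Lp ℂ 2 μ) : Lp ℂ 2 μ →L[ℂ] Lp ℂ 2 μ :=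
  (BoundedContinuousFunction.toLp 2 μ ℂ).comp (correlation μ K)

theorem coeFn_correlationL2 (K f : Lp ℂ 2 μ) :
    correlationL2 μ K f =ᵐ[μ] fun x => inner ℂ K (translateL2 μ x f) :=
  BoundedContinuousFunction.coeFn_toLp (p := 2) (𝕜 := ℂ) μ (correlation μ K f)

theorem isCompactOperator_correlationL2 (K : Lp ℂ 2 μ) :
    IsCompactOperator (correlationL2 μ K) :=
  (isCompactOperator_correlation μ K).clm_comp (BoundedContinuousFunction.toLp 2 μ ℂ)

theorem correlationL2_translateL2 (K f : Lp ℂ 2 μ) (x : G) :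
    correlationL2 μ K (translateL2 μ x f) = translateL2 μ x (correlationL2 μ K f) := by
  refine Lp.ext ?_
  have h := (measurePreserving_mul_left μ x).quasiMeasurePreserving.ae (coeFn_correlationL2 μ K f)
  filter_upwards [coeFn_correlationL2 μ K (translateL2 μ x f),
    coeFn_translateL2 μ x (correlationL2 μ K f), h] with ω h1 h2 h3
  rw [h1, h2, h3, translateL2_mul, translateL2_comm]

/-- The correlation of `K` with itself is continuous with value `‖K‖²` at `1`, and a continuous
function vanishing Haar-almost everywhere vanishes identically. -/
theorem correlationL2_self_ne_zero {K : Lp ℂ 2 μ} (hK : K ≠ 0) : correlationL2 μ K K ≠ 0 := by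
  intro h
  have h0 : (fun x => inner ℂ K (translateL2 μ x K)) =ᵐ[μ] fun _ => (0 : ℂ) := by
    filter_upwards [coeFn_correlationL2 μ K K, Lp.coeFn_zero ℂ 2 μ] with x h1 h2
    rw [← h1, h, h2]; rfl
  have h1 := (Continuous.ae_eq_iff_eq μ (continuous_const.inner (continuous_translateL2 μ K))
    continuous_const).1 h0
  have h2 := congrFun h1 1
  simp only [translateL2_one, inner_self_eq_zero] at h2
  exact hK h2

/-- A nonzero closed translation-invariant subspace of `L²(G)` contains a common eigenvector of all
translations. -/
theorem exists_eigenvector_translateL2 (W : Submodule ℂ (Lp ℂ 2 μ))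
    (hWc : IsClosed (W : Set (Lp ℂ 2 μ)))
    (hW : ∀ x, ∀ f ∈ W, translateL2 μ x f ∈ W) (hne : W ≠ ⊥) :
    ∃ e ∈ W, e ≠ 0 ∧ ∀ x, ∃ c : ℂ, translateL2 μ x e = c • e := by
  have : CompleteSpace W := hWc.completeSpace_coe
  obtain ⟨K, hKW, hK⟩ := W.ne_bot_iff.1 hne
  let T : W →L[ℂ] Lp ℂ 2 μ := (correlationL2 μ K).comp W.subtypeL
  -- `T` need not map `W` into itself; composing with the adjoint returns to `W` and makes the
  -- operator self-adjoint. It stays compact, nonzero and commutes with translations.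
  let A : W →L[ℂ] W := (ContinuousLinearMap.adjoint T).comp T
  let U : G → Module.End ℂ W := fun x => (translateL2 μ x).toLinearMap.restrict (hW x)
  have hU : ∀ x (w : W), ((U x w : W) : Lp ℂ 2 μ) = translateL2 μ x w := fun _ _ => rfl
  have hTU : ∀ x (w : W), T (U x w) = translateL2 μ x (T w) := fun x w =>
    correlationL2_translateL2 μ K w x
  have hAinner : ∀ v w : W, inner ℂ (A v) w = inner ℂ (T v) (T w) := fun v w => by
    simp only [A, ContinuousLinearMap.comp_apply, ContinuousLinearMap.adjoint_inner_left]
  have hAU : ∀ x (w : W), A (U x w) = U x (A w) := by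
    intro x w
    refine ext_inner_right ℂ fun v => ?_
    rw [hAinner, hTU, inner_translateL2_left, ← hTU, ← hAinner]
    change inner ℂ ((A w : W) : Lp ℂ 2 μ) (translateL2 μ x⁻¹ v) =
      inner ℂ (translateL2 μ x (A w : W)) (v : Lp ℂ 2 μ)
    rw [inner_translateL2_left]
  have hAc : IsCompactOperator A :=
    ((isCompactOperator_correlationL2 μ K).comp_clm W.subtypeL).clm_comp
      (ContinuousLinearMap.adjoint T)
  have hAs : (A : W →ₗ[ℂ] W).IsSymmetric := fun v w => by
    change inner ℂ (A v) w = inner ℂ v (A w)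
    rw [hAinner, ← inner_conj_symm v, hAinner, inner_conj_symm]
  have hA0 : A ≠ 0 := by
    intro h
    have h1 := hAinner ⟨K, hKW⟩ ⟨K, hKW⟩
    rw [h, zero_apply, inner_zero_left, eq_comm, inner_self_eq_zero] at h1
    exact correlationL2_self_ne_zero μ hK h1
  -- A nonzero compact self-adjoint operator has a nonzero eigenvalue, and only for such eigenvalues
  -- is the eigenspace finite-dimensional.
  obtain ⟨c, hc, hc0⟩ : ∃ c, Module.End.HasEigenvalue (A : Module.End ℂ W) c ∧ c ≠ 0 := by
    by_contra! h
    exact hA0 ((ContinuousLinearMap.eq_zero_of_forall_hasEigenvalue_eq_zero hAc hAs).1 h)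
  set E := Module.End.eigenspace (A : Module.End ℂ W) c with hE
  have : FiniteDimensional ℂ E :=
    ContinuousLinearMap.finite_dimensional_eigenspace hAc c hc0
  have : Nontrivial E := Submodule.nontrivial_iff_ne_bot.2 hc
  have hUE : ∀ x, ∀ w ∈ E, U x w ∈ E := by
    intro x w hw
    rw [hE, Module.End.mem_eigenspace_iff] at hw ⊢
    change A (U x w) = _
    rw [hAU, show A w = c • w from hw, map_smul]
  obtain ⟨v, hv, hv'⟩ := Module.End.exists_common_eigenvector _
    (fun x => (U x).restrict (hUE x)) (fun x y => by
      refine LinearMap.ext fun w => Subtype.ext (Subtype.ext ?_)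
      exact translateL2_comm μ x y w) rfl
  refine ⟨v.1.1, v.1.2, by simpa using hv, fun x => (hv' x).imp fun d hd => ?_⟩
  exact congrArg (fun w : E => (w.1.1 : Lp ℂ 2 μ)) hd

end Compact

/-! ### Characters: density and uniqueness of Fourier coefficients -/

section Compact

variable {G : Type*} [CommGroup G] [TopologicalSpace G]

/-- A character, as a complex-valued continuous function. -/
def PontryaginDual.toContinuousMap (χ : PontryaginDual G) : C(G, ℂ) :=
  ⟨fun ω => ((χ ω : Circle) : ℂ), continuous_subtype_val.comp (map_continuous χ)⟩

@[simp]
theorem PontryaginDual.toContinuousMap_apply (χ : PontryaginDual G) (ω : G) :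
    χ.toContinuousMap ω = ((χ ω : Circle) : ℂ) := rfl

/-- An integrable function on a compact space with vanishing integral against all continuous
functions vanishes almost everywhere. -/
theorem ae_eq_zero_of_forall_integral_mul_continuousMap {X : Type*} [TopologicalSpace X]
    [CompactSpace X] [T2Space X] [MeasurableSpace X] [BorelSpace X] (ν : Measure X)
    [ν.Regular] (F : X → ℂ) (hF : Integrable F ν)
    (h : ∀ φ : C(X, ℂ), ∫ x, F x * φ x ∂ν = 0) : F =ᵐ[ν] 0 := by
  refine ae_eq_zero_of_forall_setIntegral_isClosed_eq_zero hF fun K hK => ?_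
  rw [← norm_le_zero_iff]
  refine le_of_forall_pos_le_add fun ε hε => ?_
  -- Absolute continuity of the integral: the Urysohn function below differs from the indicator of
  -- `K` only on `V \ K`, whose measure is less than `δ`, so the error is at most `ε`.
  obtain ⟨δ, hδ, hδ'⟩ := exists_pos_setLIntegral_lt_of_measure_lt (μ := ν) (f := fun x => ‖F x‖ₑ)
    hF.2.ne (ε := ENNReal.ofReal ε) (by simpa using hε)
  obtain ⟨V, hKV, hV, hVm⟩ := K.exists_isOpen_lt_add (μ := ν) hK.isCompact.measure_lt_top.ne hδ.ne'
  obtain ⟨φ, h0, h1, h01⟩ := exists_continuous_zero_one_of_isClosed hV.isClosed_compl hK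
    (Set.disjoint_compl_left_iff_subset.2 hKV)
  have hdiff : ν (V \ K) < δ := by
    rw [measure_sdiff hKV hK.measurableSet.nullMeasurableSet hK.isCompact.measure_lt_top.ne]
    exact ENNReal.sub_lt_of_lt_add (measure_mono hKV) (by rwa [add_comm])
  have h2 := hδ' _ hdiff
  have h3 := h ⟨fun x => (φ x : ℂ), by fun_prop⟩
  simp only [ContinuousMap.coe_mk] at h3
  have hbd : Integrable (fun x => F x * (φ x : ℂ)) ν := by
    refine hF.mul_bdd (c := 1) (by fun_prop) (Eventually.of_forall fun x => ?_)
    rw [Complex.norm_real, Real.norm_eq_abs, abs_of_nonneg (h01 x).1]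
    exact (h01 x).2
  rw [zero_add, ← integral_indicator hK.measurableSet, ← sub_zero (∫ _, _ ∂ν), ← h3,
    ← integral_sub (hF.indicator hK.measurableSet) hbd]
  refine (norm_integral_le_lintegral_norm _).trans ?_
  refine ENNReal.toReal_le_of_le_ofReal hε.le (le_trans ?_ h2.le)
  rw [← lintegral_indicator (hV.measurableSet.diff hK.measurableSet)]
  refine lintegral_mono fun x => ?_
  by_cases hxK : x ∈ K
  · simp [hxK, h1 hxK]
  · by_cases hxV : x ∈ V
    · simp only [hxK, not_false_eq_true, Set.indicator_of_notMem, zero_sub, norm_neg,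
        Set.mem_sdiff, hxV, and_self, Set.indicator_of_mem]
      rw [ofReal_norm, enorm_mul]
      refine mul_le_of_le_one_right' ?_
      rw [← ofReal_norm, Complex.norm_real, Real.norm_eq_abs, abs_of_nonneg (h01 x).1]
      simpa using (h01 x).2
    · simp [hxK, h0 hxV]

/-- The functional `φ ↦ ∫ F φ` on the continuous functions, for `F` integrable. -/
def integralAgainst {X : Type*} [TopologicalSpace X] [CompactSpace X] [MeasurableSpace X]
    [BorelSpace X] (ν : Measure X) (F : X → ℂ) (hF : Integrable F ν) : C(X, ℂ) →L[ℂ] ℂ :=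
  have hint : ∀ φ : C(X, ℂ), Integrable (fun x => F x * φ x) ν := fun φ =>
    hF.mul_bdd (c := ‖φ‖) (by fun_prop) (Eventually.of_forall fun x => φ.norm_coe_le_norm x)
  LinearMap.mkContinuous
    { toFun := fun φ => ∫ x, F x * φ x ∂ν
      map_add' := fun φ ψ => by
        rw [← integral_add (hint φ) (hint ψ)]; simp [mul_add]
      map_smul' := fun c φ => by
        simp only [ContinuousMap.smul_apply, smul_eq_mul, RingHom.id_apply]
        rw [← integral_const_mul]
        congr 1; ext x; ring } (∫ x, ‖F x‖ ∂ν) (fun φ => by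
      refine (norm_integral_le_integral_norm _).trans ?_
      rw [← integral_mul_const]
      refine integral_mono (hint φ).norm (hF.norm.mul_const _) fun x => ?_
      rw [norm_mul]
      exact mul_le_mul_of_nonneg_left (φ.norm_coe_le_norm x) (norm_nonneg _))

theorem integralAgainst_apply {X : Type*} [TopologicalSpace X] [CompactSpace X]
    [MeasurableSpace X] [BorelSpace X] (ν : Measure X) (F : X → ℂ) (hF : Integrable F ν)
    (φ : C(X, ℂ)) : integralAgainst ν F hF φ = ∫ x, F x * φ x ∂ν := rfl

variable [IsTopologicalGroup G] [CompactSpace G]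
    [MeasurableSpace G] [BorelSpace G] (μ : Measure G) [μ.IsHaarMeasure]

/-- An integrable function on `G` that is invariant almost everywhere under every translation is
constant almost everywhere. -/
theorem exists_ae_eq_const_of_forall_translate [T2Space G] (F : G → ℂ) (hF : Integrable F μ)
    (h : ∀ x, (fun ω => F (x * ω)) =ᵐ[μ] F) : ∃ c, F =ᵐ[μ] Function.const G c := by
  set m : ℂ := (μ.real Set.univ : ℂ) with hm
  have hm0 : m ≠ 0 := by
    rw [hm, Complex.ofReal_ne_zero]
    exact (measureReal_univ_pos (μ := μ)).ne'
  refine ⟨(∫ ω, F ω ∂μ) / m, ?_⟩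
  -- The double integral of `F(ω) φ(xω)` is computed in two ways. The integral over `x` is taken in
  -- the Banach space `C(G, ℂ)` and exchanged with the functional `integralAgainst`. This avoids
  -- Fubini on `G × G`, where the Borel σ-algebra may exceed the product one.
  have key : ∀ φ : C(G, ℂ), m * ∫ ω, F ω * φ ω ∂μ = (∫ ω, φ ω ∂μ) * ∫ ω, F ω ∂μ := by
    intro φ
    have hc : Continuous fun p : G × G => φ (p.1 * p.2) := by fun_prop
    let Ψ : C(G, C(G, ℂ)) := (⟨fun p : G × G => φ (p.1 * p.2), hc⟩ : C(G × G, ℂ)).curry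
    have hΨ : Integrable Ψ μ := Ψ.continuous.integrable_of_hasCompactSupport
      (HasCompactSupport.of_compactSpace _)
    have h1 : ∀ x, integralAgainst μ F hF (Ψ x) = ∫ ω, F ω * φ ω ∂μ := by
      intro x
      rw [integralAgainst_apply, ← integral_mul_left_eq_self (fun ω => F ω * φ ω) x]
      refine integral_congr_ae ?_
      filter_upwards [h x] with ω hω
      rw [hω]; rfl
    have h2 : ∫ x, Ψ x ∂μ = (∫ ω, φ ω ∂μ) • (1 : C(G, ℂ)) := by
      ext ω
      rw [ContinuousMap.integral_apply hΨ]
      simp only [ContinuousMap.smul_apply, ContinuousMap.one_apply, smul_eq_mul, mul_one]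
      exact integral_mul_right_eq_self (fun x => φ x) ω
    have h3 := (integralAgainst μ F hF).integral_comp_comm hΨ
    simp only [h1, h2, map_smul, integral_const, integralAgainst_apply, ContinuousMap.one_apply,
      mul_one, smul_eq_mul] at h3
    rw [← h3, hm, Complex.real_smul]
  have h0 := ae_eq_zero_of_forall_integral_mul_continuousMap μ
    (fun ω => F ω - (∫ ω, F ω ∂μ) / m) (hF.sub (integrable_const _)) (fun φ => by
      have hint : Integrable (fun ω => F ω * φ ω) μ :=
        hF.mul_bdd (c := ‖φ‖) (by fun_prop) (Eventually.of_forall fun x => φ.norm_coe_le_norm x)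
      have hφ : Integrable φ μ := φ.continuous.integrable_of_hasCompactSupport
        (HasCompactSupport.of_compactSpace _)
      simp only [sub_mul]
      rw [integral_sub hint (hφ.const_mul _), integral_const_mul]
      have := key φ
      field_simp
      linear_combination this)
  filter_upwards [h0] with ω hω
  exact sub_eq_zero.1 hω

/-- A common eigenvector of all translations is a multiple of a character. -/
theorem exists_eq_smul_char_of_eigenvector [T2Space G] (e : Lp ℂ 2 μ) (he : e ≠ 0)
    (h : ∀ x, ∃ c : ℂ, translateL2 μ x e = c • e) :
    ∃ (χ : PontryaginDual G) (a : ℂ), e = a • ContinuousMap.toLp 2 μ ℂ χ.toContinuousMap := by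
  choose c hc using h
  have hone : c 1 = 1 := by
    have h1 := hc 1
    rw [translateL2_one] at h1
    exact (smul_left_injective ℂ he ((one_smul ℂ e).trans h1)).symm
  have hmul : ∀ x y, c (x * y) = c x * c y := by
    intro x y
    refine smul_left_injective ℂ he ?_
    change c (x * y) • e = (c x * c y) • e
    rw [← hc, translateL2_mul, hc y, map_smul, hc x, smul_smul, mul_comm]
  have hnorm : ∀ x, ‖c x‖ = 1 := by
    intro x
    have h1 := (translateL2 μ x).norm_map e
    rw [hc, norm_smul] at h1
    exact (mul_eq_right₀ (norm_ne_zero_iff.2 he)).1 h1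
  have hcont : Continuous c := by
    have h1 : c = fun x => inner ℂ e (translateL2 μ x e) / inner ℂ e e := by
      funext x
      rw [hc, inner_smul_right, mul_div_cancel_right₀ _ (inner_self_ne_zero.2 he)]
    rw [h1]
    exact (continuous_const.inner (continuous_translateL2 μ e)).div_const _
  let χ' : G →ₜ* Circle :=
    { toFun := fun x => ⟨c x, mem_sphere_zero_iff_norm.2 (hnorm x)⟩
      map_one' := Circle.ext hone
      map_mul' := fun x y => Circle.ext (hmul x y)
      continuous_toFun := hcont.subtype_mk _ }
  let χ : PontryaginDual G := χ'
  have hχ : ∀ x, ((χ x : Circle) : ℂ) = c x := fun x => rfl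
  -- The eigenvalue function `c` is itself a character, and `conj c · e` is translation invariant,
  -- hence constant.
  obtain ⟨a, ha⟩ := exists_ae_eq_const_of_forall_translate μ
    (fun ω => (starRingEnd ℂ) (c ω) * e ω)
    (((Lp.memLp e).integrable (by norm_num)).bdd_mul (c := 1)
      (Complex.continuous_conj.comp hcont).aestronglyMeasurable
      (Eventually.of_forall fun x => by
        simp [hnorm]))
    (fun x => by
      filter_upwards [coeFn_translateL2 μ x e, Lp.coeFn_smul (c x) e] with ω h1 h2
      rw [← h1, hc, h2, hmul, Pi.smul_apply, smul_eq_mul, map_mul]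
      have h3 : (starRingEnd ℂ) (c x) * c x = 1 := by
        rw [Complex.conj_mul', hnorm]; simp
      linear_combination ((starRingEnd ℂ) (c ω) * e ω) * h3)
  refine ⟨χ, a, Lp.ext ?_⟩
  filter_upwards [ha, Lp.coeFn_smul a (ContinuousMap.toLp 2 μ ℂ χ.toContinuousMap),
    ContinuousMap.coeFn_toLp (p := 2) (𝕜 := ℂ) μ χ.toContinuousMap] with ω h1 h2 h3
  rw [h2, Pi.smul_apply, h3, PontryaginDual.toContinuousMap_apply, hχ, smul_eq_mul]
  rw [Function.const_apply] at h1
  have h3 : c ω * (starRingEnd ℂ) (c ω) = 1 := by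
    rw [Complex.mul_conj', hnorm]; simp
  linear_combination c ω * h1 - e ω * h3

theorem translateL2_char (χ : PontryaginDual G) (x : G) :
    translateL2 μ x (ContinuousMap.toLp 2 μ ℂ χ.toContinuousMap) =
      ((χ x : Circle) : ℂ) • ContinuousMap.toLp 2 μ ℂ χ.toContinuousMap := by
  refine Lp.ext ?_
  have h := ContinuousMap.coeFn_toLp (p := 2) (𝕜 := ℂ) μ χ.toContinuousMap
  filter_upwards [coeFn_translateL2 μ x (ContinuousMap.toLp 2 μ ℂ χ.toContinuousMap), h,
    (measurePreserving_mul_left μ x).quasiMeasurePreserving.ae h,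
    Lp.coeFn_smul ((χ x : Circle) : ℂ) (ContinuousMap.toLp 2 μ ℂ χ.toContinuousMap)]
    with ω h1 h2 h3 h4
  rw [h1, h3, h4, Pi.smul_apply, h2]
  simp

/-- The characters of a compact abelian group span a dense subspace of `L²(G)`. -/
theorem span_char_orthogonal_eq_bot [T2Space G] :
    (Submodule.span ℂ (Set.range fun χ : PontryaginDual G =>
      ContinuousMap.toLp 2 μ ℂ χ.toContinuousMap))ᗮ = (⊥ : Submodule ℂ (Lp ℂ 2 μ)) := by
  set W := (Submodule.span ℂ (Set.range fun χ : PontryaginDual G =>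
      ContinuousMap.toLp 2 μ ℂ χ.toContinuousMap))ᗮ with hWdef
  have hmem : ∀ f : Lp ℂ 2 μ, f ∈ W ↔ ∀ χ : PontryaginDual G,
      inner ℂ (ContinuousMap.toLp 2 μ ℂ χ.toContinuousMap : Lp ℂ 2 μ) f = 0 := by
    intro f
    rw [hWdef, Submodule.mem_orthogonal]
    refine ⟨fun h χ => h _ (Submodule.subset_span ⟨χ, rfl⟩), fun h u hu => ?_⟩
    induction hu using Submodule.span_induction with
    | mem _ hx => obtain ⟨χ, rfl⟩ := hx; exact h χ
    | zero => exact inner_zero_left _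
    | add u v _ _ hu hv => rw [inner_add_left, hu, hv, add_zero]
    | smul c u _ hu => rw [inner_smul_left, hu, mul_zero]
  by_contra hne
  obtain ⟨e, heW, he, hc⟩ := exists_eigenvector_translateL2 μ W
    (Submodule.isClosed_orthogonal _) (fun x f hf => by
      rw [hmem] at hf ⊢
      intro χ
      rw [inner_translateL2_right, translateL2_char, inner_smul_left, hf, mul_zero]) hne
  obtain ⟨χ, a, rfl⟩ := exists_eq_smul_char_of_eigenvector μ e he hc
  have h1 := (hmem _).1 heW χ
  rw [inner_smul_right, mul_eq_zero, inner_self_eq_zero] at h1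
  rcases h1 with h1 | h1 <;> simp [h1] at he

/-- The characters of a compact Hausdorff abelian group separate its points. -/
theorem PontryaginDual.exists_apply_ne [T2Space G] {x y : G} (hxy : x ≠ y) :
    ∃ χ : PontryaginDual G, χ x ≠ χ y := by
  by_contra! hχ
  let ν : Measure G := Measure.haar
  -- If no character distinguishes `x` from `y`, translation by `x y⁻¹` fixes every character, hence
  -- all of `L²`. Continuous functions would then fail to separate the two points, against Urysohn.
  have hid : ∀ f : Lp ℂ 2 ν, translateL2 ν (x * y⁻¹) f = f := by
    intro f
    have h : translateL2 ν (x * y⁻¹) f - f ∈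
        (Submodule.span ℂ (Set.range fun χ : PontryaginDual G =>
          ContinuousMap.toLp 2 ν ℂ χ.toContinuousMap))ᗮ := by
      rw [Submodule.mem_orthogonal]
      intro u hu
      induction hu using Submodule.span_induction with
      | mem _ hx =>
        obtain ⟨χ, rfl⟩ := hx
        rw [inner_sub_right, inner_translateL2_right, translateL2_char]
        simp [hχ]
      | zero => exact inner_zero_left _
      | add u v _ _ hu hv => rw [inner_add_left, hu, hv, add_zero]
      | smul c u _ hu => rw [inner_smul_left, hu, mul_zero]
    rw [span_char_orthogonal_eq_bot, Submodule.mem_bot] at h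
    exact sub_eq_zero.1 h
  obtain ⟨φ, hφ⟩ : ∃ φ : C(G, ℝ), φ x ≠ φ y := by
    have h := exists_continuous_zero_one_of_isClosed (isClosed_singleton (x := x))
      (isClosed_singleton (x := y)) (by simpa using hxy)
    obtain ⟨φ, h0, h1, -⟩ := h
    exact ⟨φ, by rw [h0 rfl, h1 rfl]; simp⟩
  let Φ : C(G, ℂ) := ⟨fun z => (φ z : ℂ), by fun_prop⟩
  have hae : (fun z => Φ (x * y⁻¹ * z)) =ᵐ[ν] Φ := by
    have h := ContinuousMap.coeFn_toLp (p := 2) (𝕜 := ℂ) ν Φ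
    have h1 := coeFn_translateL2 ν (x * y⁻¹) (ContinuousMap.toLp 2 ν ℂ Φ)
    rw [hid] at h1
    filter_upwards [h, h1,
      (measurePreserving_mul_left ν (x * y⁻¹)).quasiMeasurePreserving.ae h] with z h2 h3 h4
    rw [← h2, h3, h4]
  have heq := (Continuous.ae_eq_iff_eq ν (by fun_prop) (by fun_prop)).1 hae
  have := congrFun heq y
  simp only [inv_mul_cancel_right] at this
  exact hφ (Complex.ofReal_injective this)

/-- The star subalgebra of `C(G, ℂ)` consisting of the trigonometric polynomials. -/
def trigPolynomials (G : Type*) [CommGroup G] [TopologicalSpace G] [IsTopologicalGroup G]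
    [CompactSpace G] : StarSubalgebra ℂ C(G, ℂ) where
  carrier := Submodule.span ℂ (Set.range (PontryaginDual.toContinuousMap (G := G)))
  mul_mem' := by
    intro a b ha hb
    refine Submodule.span_induction₂ (p := fun a b _ _ => a * b ∈ Submodule.span ℂ
      (Set.range (PontryaginDual.toContinuousMap (G := G)))) ?_ ?_ ?_ ?_ ?_ ?_ ?_ ha hb
    · rintro _ _ ⟨χ, rfl⟩ ⟨χ', rfl⟩
      refine Submodule.subset_span ⟨χ * χ', ?_⟩
      ext ω
      rfl
    · intro b hb; simp
    · intro b hb; simp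
    · intro a b c _ _ _ h1 h2; rw [add_mul]; exact add_mem h1 h2
    · intro a b c _ _ _ h1 h2; rw [mul_add]; exact add_mem h1 h2
    · intro c a b _ _ h; rw [smul_mul_assoc]; exact Submodule.smul_mem _ _ h
    · intro c a b _ _ h; rw [mul_smul_comm]; exact Submodule.smul_mem _ _ h
  add_mem' := fun ha hb => add_mem ha hb
  algebraMap_mem' := by
    intro c
    have h : (algebraMap ℂ C(G, ℂ)) c = c • (1 : PontryaginDual G).toContinuousMap := by
      ext ω; simp
    rw [h]
    exact Submodule.smul_mem _ _ (Submodule.subset_span ⟨1, rfl⟩)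
  star_mem' := by
    intro a ha
    induction ha using Submodule.span_induction with
    | mem _ hx =>
      obtain ⟨χ, rfl⟩ := hx
      refine Submodule.subset_span ⟨χ⁻¹, ?_⟩
      ext ω
      exact Circle.coe_inv_eq_conj _
    | zero => simp
    | add u v _ _ hu hv => rw [star_add]; exact add_mem hu hv
    | smul c u _ hu => rw [star_smul]; exact Submodule.smul_mem _ _ hu

/-- Stone–Weierstrass, point separation being `PontryaginDual.exists_apply_ne`. -/
theorem span_char_topologicalClosure_eq_top [T2Space G] :
    (Submodule.span ℂ (Set.range (PontryaginDual.toContinuousMap (G := G)))).topologicalClosure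
      = ⊤ := by
  have h := ContinuousMap.starSubalgebra_topologicalClosure_eq_top_of_separatesPoints
    (trigPolynomials G) (fun x y hxy => by
      obtain ⟨χ, hχ⟩ := PontryaginDual.exists_apply_ne hxy
      refine ⟨_, ⟨χ.toContinuousMap, Submodule.subset_span ⟨χ, rfl⟩, rfl⟩, fun h => ?_⟩
      exact hχ (Circle.ext h))
  exact congrArg (Subalgebra.toSubmodule <| StarSubalgebra.toSubalgebra ·) h

/-- The characters of a compact Hausdorff abelian group span a dense subspace of `L¹(G)`. -/
theorem span_charL1_topologicalClosure_eq_top [T2Space G] :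
    (Submodule.span ℂ (Set.range fun χ : PontryaginDual G =>
      (ContinuousMap.toLp 1 μ ℂ χ.toContinuousMap : Lp ℂ 1 μ))).topologicalClosure = ⊤ := by
  convert! (ContinuousMap.toLp_denseRange ℂ μ ℂ (p := 1) (by simp)).topologicalClosure_map_submodule
      (span_char_topologicalClosure_eq_top (G := G))
  rw [Submodule.map_span, ← Set.range_comp]
  rfl

/-- An integrable function on a compact Hausdorff abelian group is determined by its Fourier
coefficients. -/
theorem GenDirichlet.ae_eq_zero_of_groupFourier_eq_zero [T2Space G] (F : G → ℂ)
    (hF : Integrable F μ) (h : ∀ χ : PontryaginDual G, GenDirichlet.groupFourier μ F χ = 0) :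
    F =ᵐ[μ] 0 := by
  refine ae_eq_zero_of_forall_integral_mul_continuousMap μ F hF fun φ => ?_
  let Λ := integralAgainst μ F hF
  have hle : Submodule.span ℂ (Set.range (PontryaginDual.toContinuousMap (G := G))) ≤
      LinearMap.ker Λ.toLinearMap := by
    rw [Submodule.span_le]
    rintro _ ⟨χ, rfl⟩
    have := h χ⁻¹
    rw [GenDirichlet.groupFourier] at this
    change ∫ x, F x * χ.toContinuousMap x ∂μ = 0
    rw [← this]
    refine integral_congr_ae (Eventually.of_forall fun x => ?_)
    change F x * ((χ x : Circle) : ℂ) = F x * (starRingEnd ℂ) (((χ x)⁻¹ : Circle) : ℂ)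
    rw [Circle.coe_inv_eq_conj, Complex.conj_conj]
  have hcl := Submodule.topologicalClosure_minimal _ hle Λ.isClosed_ker
  rw [span_char_topologicalClosure_eq_top] at hcl
  exact hcl (Submodule.mem_top : φ ∈ _)

end Compact

/-! ### Maximal averages on the line -/

/-- A local weak type estimate for the Hardy-Littlewood maximal function on the line. -/
theorem Real.volume_average_ge_le (h : ℝ → ℝ≥0∞) (s : ℝ≥0∞) (L : ℝ) :
    s * volume {t ∈ Set.Icc (-L) L | ∃ r, 0 < r ∧ r ≤ L ∧
      s * ENNReal.ofReal r ≤ ∫⁻ u in Metric.closedBall t r, h u} ≤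
      10 * ∫⁻ u in Set.Icc (-(2 * L)) (2 * L), h u := by
  set E := {t ∈ Set.Icc (-L) L | ∃ r, 0 < r ∧ r ≤ L ∧
      s * ENNReal.ofReal r ≤ ∫⁻ u in Metric.closedBall t r, h u} with hE
  have hex : ∀ t, ∃ r, t ∈ E → 0 < r ∧ r ≤ L ∧
      s * ENNReal.ofReal r ≤ ∫⁻ u in Metric.closedBall t r, h u := fun t => by
    by_cases ht : t ∈ E
    · obtain ⟨r, hr⟩ := ht.2
      exact ⟨r, fun _ => hr⟩
    · exact ⟨0, fun h => absurd h ht⟩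
  choose r hr using hex
  obtain ⟨u, huE, hdisj, hcov⟩ := Vitali.exists_disjoint_subfamily_covering_enlargement_closedBall
    E id r L (fun t ht => (hr t ht).2.1) 5 (by norm_num)
  simp only [id] at hdisj hcov
  have hucount : u.Countable := hdisj.countable_of_nonempty_interior fun t ht => by
    have h1 := (hr t (huE ht)).1
    exact ⟨t, Metric.ball_subset_interior_closedBall (Metric.mem_ball_self h1)⟩
  have hsub : E ⊆ ⋃ b ∈ u, Metric.closedBall b (5 * r b) := fun t ht => by
    obtain ⟨b, hb, hb'⟩ := hcov t ht
    exact Set.mem_biUnion hb (hb' (Metric.mem_closedBall_self (hr t ht).1.le))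
  calc s * volume E ≤ s * ∑' b : u, volume (Metric.closedBall (b : ℝ) (5 * r b)) := by
        gcongr
        exact (measure_mono hsub).trans (measure_biUnion_le _ hucount _)
    _ = ∑' b : u, s * volume (Metric.closedBall (b : ℝ) (5 * r b)) := ENNReal.tsum_mul_left.symm
    _ ≤ ∑' b : u, 10 * ∫⁻ v in Metric.closedBall (b : ℝ) (r b), h v := by
        refine ENNReal.tsum_le_tsum fun b => ?_
        have h1 := (hr b (huE b.2)).2.2
        rw [Real.volume_closedBall, show 2 * (5 * r b) = 10 * r b by ring,
          ENNReal.ofReal_mul (by norm_num), ← mul_assoc, mul_comm s, mul_assoc]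
        simpa using mul_le_mul_right h1 (10 : ℝ≥0∞)
    _ = 10 * ∫⁻ v in ⋃ b ∈ u, Metric.closedBall b (r b), h v := by
        rw [ENNReal.tsum_mul_left, lintegral_biUnion hucount
          (fun b _ => Metric.isClosed_closedBall.measurableSet) hdisj]
    _ ≤ 10 * ∫⁻ v in Set.Icc (-(2 * L)) (2 * L), h v := by
        gcongr
        refine Set.iUnion₂_subset fun b hb => ?_
        have h1 := huE hb
        have h2 := (hr b h1).2.1
        rw [Real.closedBall_eq_Icc]
        exact Set.Icc_subset_Icc (by linarith [h1.1.1]) (by linarith [h1.1.2])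

/-- The dyadic maximal average at the origin. -/
def dyadicMax (h : ℝ → ℝ≥0∞) : ℝ≥0∞ :=
  ⨆ k : ℤ, (ENNReal.ofReal (2 ^ k))⁻¹ * ∫⁻ t in Metric.closedBall (0 : ℝ) (2 ^ k), h t

/-- Integration against a radially nonincreasing kernel is controlled by the dyadic maximal
average. -/
theorem lintegral_mul_radial_le (h : ℝ → ℝ≥0∞) (hh : Measurable h) (Ψ : ℝ → ℝ≥0∞)
    (hΨ : AntitoneOn Ψ (Set.Ioi 0)) :
    ∫⁻ t, h t * Ψ |t| ≤ 4 * (∫⁻ t in Set.Ioi 0, Ψ t) * dyadicMax h := by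
  have hpos : ∀ k : ℤ, (0 : ℝ) < 2 ^ k := fun k => zpow_pos two_pos k
  -- On the shell `2^(k+1) < |t| ≤ 2^(k+2)` the kernel is at most `Ψ(2^(k+1))`, which is compared
  -- with its integral over the preceding interval, of length `2^k`. The ball of radius `2^(k+2)`
  -- containing the shell then gives the factor `4`.
  let S : ℤ → Set ℝ := fun k => {t | |t| ∈ Set.Ioc ((2 : ℝ) ^ (k + 1)) (2 ^ (k + 2))}
  have hSm : ∀ k, MeasurableSet (S k) := fun k => measurableSet_Ioc.preimage (by fun_prop)
  have hcov : (Set.univ : Set ℝ) =ᵐ[volume] ⋃ k, S k := by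
    have h0 : ∀ᵐ t : ℝ, t ≠ 0 := by simp [ae_iff]
    filter_upwards [h0] with t ht
    refine propext ⟨fun _ => ?_, fun _ => trivial⟩
    obtain ⟨n, hn⟩ := exists_mem_Ioc_zpow (abs_pos.2 ht) (one_lt_two (α := ℝ))
    refine Set.mem_iUnion.2 ⟨n - 1, ?_⟩
    change |t| ∈ Set.Ioc _ _
    rwa [sub_add_cancel, show n - 1 + 2 = n + 1 by ring]
  have hball : ∀ k : ℤ, ∫⁻ t in Metric.closedBall (0 : ℝ) (2 ^ k), h t ≤
      ENNReal.ofReal (2 ^ k) * dyadicMax h := by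
    intro k
    have h1 : (ENNReal.ofReal (2 ^ k))⁻¹ * ∫⁻ t in Metric.closedBall (0 : ℝ) (2 ^ k), h t ≤
      dyadicMax h := le_iSup (fun k : ℤ => (ENNReal.ofReal (2 ^ k))⁻¹ *
        ∫⁻ t in Metric.closedBall (0 : ℝ) (2 ^ k), h t) k
    rwa [mul_comm, ← div_eq_mul_inv, ENNReal.div_le_iff (by simp [hpos k]) (by simp),
      mul_comm] at h1
  have hΨk : ∀ k : ℤ, Ψ (2 ^ (k + 1)) * ENNReal.ofReal (2 ^ k) ≤
      ∫⁻ t in Set.Ioc ((2 : ℝ) ^ k) (2 ^ (k + 1)), Ψ t := by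
    intro k
    have h1 : ∫⁻ _ in Set.Ioc ((2 : ℝ) ^ k) (2 ^ (k + 1)), Ψ (2 ^ (k + 1)) =
        Ψ (2 ^ (k + 1)) * ENNReal.ofReal (2 ^ k) := by
      rw [setLIntegral_const, Real.volume_Ioc, zpow_add_one₀ two_ne_zero]
      congr 2
      ring
    rw [← h1]
    refine setLIntegral_mono' measurableSet_Ioc fun t ht => ?_
    exact hΨ (Set.mem_Ioi.2 ((hpos k).trans ht.1)) (Set.mem_Ioi.2 (hpos _)) ht.2
  have hdisj : Pairwise (Function.onFun Disjoint
      fun k : ℤ => Set.Ioc ((2 : ℝ) ^ k) (2 ^ (k + 1))) :=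
    (zpow_right_strictMono₀ (one_lt_two (α := ℝ))).monotone.pairwise_disjoint_on_Ioc_succ
  calc ∫⁻ t, h t * Ψ |t| = ∫⁻ t in ⋃ k, S k, h t * Ψ |t| := by
        rw [← setLIntegral_univ, setLIntegral_congr hcov]
    _ ≤ ∑' k, ∫⁻ t in S k, h t * Ψ |t| := lintegral_iUnion_le _ _
    _ ≤ ∑' k : ℤ, (4 * ∫⁻ t in Set.Ioc ((2 : ℝ) ^ k) (2 ^ (k + 1)), Ψ t) * dyadicMax h := by
        refine ENNReal.tsum_le_tsum fun k => ?_
        calc ∫⁻ t in S k, h t * Ψ |t| ≤ ∫⁻ t in S k, h t * Ψ (2 ^ (k + 1)) := by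
              refine setLIntegral_mono' (hSm k) fun t ht => ?_
              exact mul_le_mul_right (hΨ (Set.mem_Ioi.2 (hpos _))
                (Set.mem_Ioi.2 ((hpos (k + 1)).trans ht.1)) ht.1.le) _
          _ = (∫⁻ t in S k, h t) * Ψ (2 ^ (k + 1)) := lintegral_mul_const _ hh
          _ ≤ (ENNReal.ofReal (2 ^ (k + 2)) * dyadicMax h) * Ψ (2 ^ (k + 1)) := by
              gcongr
              refine le_trans (lintegral_mono_set fun t ht => ?_) (hball (k + 2))
              rw [mem_closedBall_zero_iff]
              exact ht.2
          _ = (4 * (Ψ (2 ^ (k + 1)) * ENNReal.ofReal (2 ^ k))) * dyadicMax h := by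
              rw [zpow_add₀ two_ne_zero, ENNReal.ofReal_mul (hpos k).le]
              norm_num
              ring
          _ ≤ _ := by gcongr; exact hΨk k
    _ = 4 * (∫⁻ t in ⋃ k : ℤ, Set.Ioc ((2 : ℝ) ^ k) (2 ^ (k + 1)), Ψ t) * dyadicMax h := by
        rw [ENNReal.tsum_mul_right, ENNReal.tsum_mul_left, lintegral_iUnion
          (fun _ => measurableSet_Ioc) hdisj]
    _ ≤ _ := by
        gcongr
        exact Set.iUnion_subset fun k t ht => (hpos k).trans ht.1

/-! ### Transference of the maximal inequality to the group -/

section Flow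

variable {G : Type*} [CommGroup G] [TopologicalSpace G]

/-- The flow on `G` given by a continuous one-parameter subgroup. -/
def flow (β : Multiplicative ℝ →ₜ* G) (ω : G) (t : ℝ) : G := ω * β (Multiplicative.ofAdd t)

theorem flow_flow (β : Multiplicative ℝ →ₜ* G) (ω : G) (t u : ℝ) :
    flow β (flow β ω t) u = flow β ω (t + u) := by
  simp only [flow, ofAdd_add, map_mul, mul_assoc]

variable [IsTopologicalGroup G] [MeasurableSpace G] [BorelSpace G]

omit [MeasurableSpace G] [BorelSpace G] in
theorem continuous_flow (β : Multiplicative ℝ →ₜ* G) :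
    Continuous fun p : ℝ × G => flow β p.2 p.1 :=
  continuous_snd.mul ((map_continuous β).comp (continuous_ofAdd.comp continuous_fst))

theorem measurable_flow (β : Multiplicative ℝ →ₜ* G) :
    Measurable fun p : ℝ × G => flow β p.2 p.1 :=
  (continuous_flow β).measurable

theorem measurable_flow_right (β : Multiplicative ℝ →ₜ* G) (ω : G) : Measurable (flow β ω) :=
  (measurable_flow β).comp (measurable_id.prodMk measurable_const)

variable (μ : Measure G) [μ.IsMulLeftInvariant] [SFinite μ]

omit [SFinite μ] in
theorem measurePreserving_flow (β : Multiplicative ℝ →ₜ* G) (t : ℝ) :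
    MeasurePreserving (fun ω => flow β ω t) μ μ :=
  measurePreserving_mul_right μ _

/-- Tonelli, followed by invariance of `μ` under each time-`t` map. -/
theorem lintegral_lintegral_flow (β : Multiplicative ℝ →ₜ* G) {h : G → ℝ≥0∞} (hh : Measurable h)
    (φ : ℝ → ℝ≥0∞) (ν : Measure ℝ) [SFinite ν] (hφ : AEMeasurable φ ν) :
    ∫⁻ ω, ∫⁻ t, h (flow β ω t) * φ t ∂ν ∂μ = (∫⁻ ω, h ω ∂μ) * ∫⁻ t, φ t ∂ν := by
  rw [lintegral_lintegral_swap]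
  · have : ∀ t, ∫⁻ ω, h (flow β ω t) * φ t ∂μ = (∫⁻ ω, h ω ∂μ) * φ t := fun t => by
      have hm : Measurable fun ω => h (flow β ω t) :=
        hh.comp (measurePreserving_flow μ β t).measurable
      rw [lintegral_mul_const _ hm, (measurePreserving_flow μ β t).lintegral_comp hh]
    simp only [this]
    rw [lintegral_const_mul'' _ hφ]
  · exact (hh.comp ((measurable_flow β).comp measurable_swap)).aemeasurable.mul hφ.comp_snd

theorem measurable_average (β : Multiplicative ℝ →ₜ* G) {h : G → ℝ≥0∞} (hh : Measurable h)
    (S : Set ℝ) : Measurable fun ω => ∫⁻ t in S, h (flow β ω t) :=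
  Measurable.lintegral_prod_left' (f := fun p : ℝ × G => h (flow β p.2 p.1))
    (hh.comp (measurable_flow β))

/-- The weak type `(1, 1)` inequality for the maximal averages along a one-parameter subgroup. -/
theorem mul_measure_lt_dyadicMax_flow_le (β : Multiplicative ℝ →ₜ* G) {h : G → ℝ≥0∞}
    (hh : Measurable h) (s : ℝ≥0∞) :
    s * μ {ω | s < dyadicMax fun t => h (flow β ω t)} ≤ 20 * ∫⁻ ω, h ω ∂μ := by
  have hpos : ∀ k : ℤ, (0 : ℝ) < 2 ^ k := fun k => zpow_pos two_pos k
  -- Truncating to scales at most `2^n` lets the line estimate run in a bounded window; the sets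
  -- increase to the full level set.
  let A : ℕ → Set G := fun n => {ω | ∃ k : ℤ, k ≤ n ∧ s < (ENNReal.ofReal (2 ^ k))⁻¹ *
    ∫⁻ t in Metric.closedBall (0 : ℝ) (2 ^ k), h (flow β ω t)}
  have hAmono : Monotone A := fun m n hmn ω ⟨k, hk, hk'⟩ =>
    ⟨k, hk.trans (by exact_mod_cast hmn), hk'⟩
  have hAm : ∀ n, MeasurableSet (A n) := fun n => by
    have : A n = ⋃ k : ℤ, ⋃ _ : k ≤ n, {ω | s < (ENNReal.ofReal (2 ^ k))⁻¹ *
        ∫⁻ t in Metric.closedBall (0 : ℝ) (2 ^ k), h (flow β ω t)} := by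
      ext ω; simp [A]
    rw [this]
    exact MeasurableSet.iUnion fun k => MeasurableSet.iUnion fun _ =>
      measurableSet_lt measurable_const ((measurable_average β hh _).const_mul _)
  have hUnion : {ω | s < dyadicMax fun t => h (flow β ω t)} = ⋃ n, A n := by
    ext ω
    simp only [dyadicMax, Set.mem_ofPred_eq, lt_iSup_iff, Set.mem_iUnion, A]
    refine ⟨fun ⟨k, hk⟩ => ⟨k.toNat, k, Int.self_le_toNat k, hk⟩, fun ⟨n, k, _, hk⟩ => ⟨k, hk⟩⟩
  rw [hUnion, hAmono.measure_iUnion, ENNReal.mul_iSup]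
  refine iSup_le fun n => ?_
  set L : ℝ := 2 ^ (n : ℤ) with hL
  have hL0 : 0 < L := hpos _
  -- The local line estimate on the orbit of `ω`: by the group law of the flow, an average of `h`
  -- based at `flow β ω t` is an average centred at `t` along that orbit.
  have hline : ∀ ω, s * ∫⁻ t in Set.Icc (-L) L, (A n).indicator 1 (flow β ω t) ≤
      10 * ∫⁻ u in Set.Icc (-(2 * L)) (2 * L), h (flow β ω u) := by
    intro ω
    have hm : MeasurableSet (flow β ω ⁻¹' A n) := (hAm n).preimage (measurable_flow_right β ω)
    have h1 : ∫⁻ t in Set.Icc (-L) L, (A n).indicator 1 (flow β ω t) =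
        volume (flow β ω ⁻¹' A n ∩ Set.Icc (-L) L) := by
      rw [← Measure.restrict_apply hm, ← lintegral_indicator_one hm]
      rfl
    rw [h1]
    refine le_trans (mul_le_mul_right (measure_mono ?_) _)
      (Real.volume_average_ge_le (fun u => h (flow β ω u)) s L)
    rintro t ⟨⟨k, hk, hk'⟩, htL⟩
    refine ⟨htL, 2 ^ k, hpos k, zpow_le_zpow_right₀ one_le_two hk, ?_⟩
    rw [mul_comm (ENNReal.ofReal _)⁻¹, ← div_eq_mul_inv,
      ENNReal.lt_div_iff_mul_lt (by simp [hpos k]) (by simp)] at hk'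
    refine hk'.le.trans (le_of_eq ?_)
    have hpre : (fun u => t + u) ⁻¹' Metric.closedBall t (2 ^ k) =
        Metric.closedBall (0 : ℝ) (2 ^ k) := by
      ext u; simp [Metric.mem_closedBall]
    rw [← hpre]
    simp only [flow_flow]
    exact (measurePreserving_add_left volume t).setLIntegral_comp_preimage
      Metric.isClosed_closedBall.measurableSet
      (hh.comp (measurable_flow_right β ω))
  have hint := lintegral_mono (μ := μ) hline
  have hind : Measurable ((A n).indicator (1 : G → ℝ≥0∞)) := measurable_one.indicator (hAm n)
  rw [lintegral_const_mul _ (measurable_average β hind _),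
    lintegral_const_mul _ (measurable_average β hh _)] at hint
  have e1 := lintegral_lintegral_flow μ β hind 1 (volume.restrict (Set.Icc (-L) L))
    measurable_one.aemeasurable
  have e2 := lintegral_lintegral_flow μ β hh 1 (volume.restrict (Set.Icc (-(2 * L)) (2 * L)))
    measurable_one.aemeasurable
  simp only [Pi.one_apply, mul_one, lintegral_one, Measure.restrict_apply_univ,
    Real.volume_Icc] at e1 e2
  rw [e1, e2, lintegral_indicator_one (hAm n),
    show 2 * L - -(2 * L) = 2 * (L - -L) by ring, ENNReal.ofReal_mul two_pos.le] at hint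
  -- Integration over `G` turns the windows into their lengths `2L` and `4L`. Cancelling `2L` leaves
  -- a factor `2`, whence `20 = 2 · 10` for every `n`.
  have hc0 : ENNReal.ofReal (L - -L) ≠ 0 := by
    simp only [ne_eq, ENNReal.ofReal_eq_zero, not_le]; linarith
  refine (ENNReal.mul_le_mul_iff_left hc0 ENNReal.ofReal_ne_top).1 ?_
  rw [mul_assoc]
  refine hint.trans (le_of_eq ?_)
  norm_num
  ring

end Flow

/-! ### Convolution along the flow -/

section FlowConv

variable {G : Type*} [CommGroup G] [TopologicalSpace G]

/-- The convolution of `f : G → ℂ` and `φ : ℝ → ℂ` along a one-parameter subgroup. -/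
def flowConv (β : Multiplicative ℝ →ₜ* G) (f : G → ℂ) (φ : ℝ → ℂ) (ω : G) : ℂ :=
  ∫ t, φ t * f (flow β ω t)

theorem flowConv_char (β : Multiplicative ℝ →ₜ* G) (χ : PontryaginDual G) (φ : ℝ → ℂ) (ω : G) :
    flowConv β χ.toContinuousMap φ ω =
      (∫ t, φ t * ((χ (β (Multiplicative.ofAdd t)) : Circle) : ℂ)) * ((χ ω : Circle) : ℂ) := by
  rw [flowConv, ← integral_mul_const]
  congr 1
  ext t
  simp only [flow, PontryaginDual.toContinuousMap_apply, map_mul, Circle.coe_mul]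
  ring

variable [IsTopologicalGroup G] [MeasurableSpace G] [BorelSpace G]
  (μ : Measure G) [μ.IsMulLeftInvariant] [IsFiniteMeasure μ]

/-- Convolution integrates over a single orbit, which may be a null set, so independence of the
representative needs Tonelli: a null set is met at a null set of times along almost every orbit. -/
theorem ae_ae_flow (β : Multiplicative ℝ →ₜ* G) {p : G → Prop} (hp : ∀ᵐ ω ∂μ, p ω) :
    ∀ᵐ ω ∂μ, ∀ᵐ t : ℝ, p (flow β ω t) := by
  obtain ⟨s, hs, hsm, hs0⟩ := exists_measurable_superset_of_null (ae_iff.1 hp)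
  have h1 := lintegral_lintegral_flow μ β (measurable_one.indicator hsm : Measurable
    (s.indicator (1 : G → ℝ≥0∞))) 1 volume measurable_one.aemeasurable
  rw [lintegral_indicator_one hsm, hs0, zero_mul, lintegral_eq_zero_iff
    (Measurable.lintegral_prod_left' (f := fun p : ℝ × G => s.indicator (1 : G → ℝ≥0∞)
      (flow β p.2 p.1) * (1 : ℝ → ℝ≥0∞) p.1)
      (((measurable_one.indicator hsm).comp (measurable_flow β)).mul
        (measurable_one.comp measurable_fst)))] at h1
  filter_upwards [h1] with ω hω
  have hm : Measurable fun t => s.indicator (1 : G → ℝ≥0∞) (flow β ω t) :=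
    (measurable_one.indicator hsm).comp (measurable_flow_right β ω)
  simp only [Pi.one_apply, mul_one, Pi.zero_apply] at hω
  rw [lintegral_eq_zero_iff hm] at hω
  filter_upwards [hω] with t ht
  by_contra hpt
  simp [show flow β ω t ∈ s from hs hpt] at ht

/-- The shear `(t, ω) ↦ (t, ω β(t))` preserves the product measure and carries the integrand to a
product of integrable functions. -/
theorem integrable_flow (β : Multiplicative ℝ →ₜ* G) {f : G → ℂ} (hf : Integrable f μ)
    {φ : ℝ → ℂ} (hφ : Integrable φ) :
    Integrable (fun p : ℝ × G => φ p.1 * f (flow β p.2 p.1)) (volume.prod μ) := by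
  have h : MeasurePreserving (fun p : ℝ × G => (p.1, flow β p.2 p.1)) (volume.prod μ)
      (volume.prod μ) :=
    (MeasurePreserving.id volume).skew_product (g := fun t ω => flow β ω t) (measurable_flow β)
      (Eventually.of_forall fun t => (measurePreserving_flow μ β t).map_eq)
  exact h.integrable_comp_of_integrable (hφ.mul_prod hf)

theorem integrable_flowConv (β : Multiplicative ℝ →ₜ* G) {f : G → ℂ} (hf : Integrable f μ)
    {φ : ℝ → ℂ} (hφ : Integrable φ) : Integrable (flowConv β f φ) μ :=
  (integrable_flow μ β hf hφ).integral_prod_right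

theorem flowConv_congr_ae (β : Multiplicative ℝ →ₜ* G) {f g : G → ℂ} (h : f =ᵐ[μ] g)
    (φ : ℝ → ℂ) : flowConv β f φ =ᵐ[μ] flowConv β g φ := by
  filter_upwards [ae_ae_flow μ β h] with ω hω
  refine integral_congr_ae ?_
  filter_upwards [hω] with t ht
  rw [ht]

theorem flowConv_add_ae (β : Multiplicative ℝ →ₜ* G) {f g : G → ℂ} (hf : Integrable f μ)
    (hg : Integrable g μ) {φ : ℝ → ℂ} (hφ : Integrable φ) :
    flowConv β (f + g) φ =ᵐ[μ] flowConv β f φ + flowConv β g φ := by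
  filter_upwards [(integrable_flow μ β hf hφ).prod_left_ae,
    (integrable_flow μ β hg hφ).prod_left_ae] with ω h1 h2
  rw [Pi.add_apply, flowConv, flowConv, flowConv, ← integral_add h1 h2]
  simp [mul_add]

omit [IsTopologicalGroup G] [MeasurableSpace G] [BorelSpace G] in
theorem flowConv_smul (β : Multiplicative ℝ →ₜ* G) (c : ℂ) (f : G → ℂ) (φ : ℝ → ℂ) :
    flowConv β (c • f) φ = c • flowConv β f φ := by
  ext ω
  rw [Pi.smul_apply, smul_eq_mul, flowConv, flowConv, ← integral_const_mul]
  congr 1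
  ext t
  simp only [Pi.smul_apply, smul_eq_mul]
  ring

theorem integral_norm_flowConv_le (β : Multiplicative ℝ →ₜ* G) {f : G → ℂ} (hf : Integrable f μ)
    {φ : ℝ → ℂ} (hφ : Integrable φ) :
    ∫ ω, ‖flowConv β f φ ω‖ ∂μ ≤ (∫ t, ‖φ t‖) * ∫ ω, ‖f ω‖ ∂μ := by
  have hint := (integrable_flow μ β hf hφ).norm
  calc ∫ ω, ‖flowConv β f φ ω‖ ∂μ ≤ ∫ ω, (∫ t, ‖φ t * f (flow β ω t)‖) ∂μ :=
        integral_mono (integrable_flowConv μ β hf hφ).norm hint.integral_prod_right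
          fun ω => norm_integral_le_integral_norm _
    _ = ∫ t, ∫ ω, ‖φ t * f (flow β ω t)‖ ∂μ :=
        (integral_integral_swap (f := fun t ω => ‖φ t * f (flow β ω t)‖) hint).symm
    _ = ∫ t, ‖φ t‖ * ∫ ω, ‖f ω‖ ∂μ := by
        congr 1
        ext t
        simp only [norm_mul]
        rw [integral_const_mul]
        congr 1
        exact integral_mul_right_eq_self (fun ω => ‖f ω‖) _
    _ = _ := integral_mul_const _ _

/-- Fubini and the substitution `ω ↦ ω β(t)`, under which `conj χ` acquires a unimodular factor. -/
theorem GenDirichlet.groupFourier_flowConv (β : Multiplicative ℝ →ₜ* G) {f : G → ℂ}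
    (hf : Integrable f μ) {φ : ℝ → ℂ} (hφ : Integrable φ) (χ : PontryaginDual G) :
    GenDirichlet.groupFourier μ (flowConv β f φ) χ =
      GenDirichlet.groupFourier μ f χ *
        ∫ t, φ t * ((χ (β (Multiplicative.ofAdd t)) : Circle) : ℂ) := by
  have hc : Continuous fun ω : G => (starRingEnd ℂ) ((χ ω : Circle) : ℂ) :=
    Complex.continuous_conj.comp χ.toContinuousMap.continuous
  have hint : Integrable (fun p : ℝ × G => φ p.1 * f (flow β p.2 p.1) *
      (starRingEnd ℂ) ((χ p.2 : Circle) : ℂ)) (volume.prod μ) :=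
    (integrable_flow μ β hf hφ).mul_bdd (c := 1)
      (hc.comp continuous_snd).aestronglyMeasurable
      (Eventually.of_forall fun p =>
        (RCLike.norm_conj ((χ p.2 : Circle) : ℂ)).trans_le (Circle.norm_coe _).le)
  calc GenDirichlet.groupFourier μ (flowConv β f φ) χ
      = ∫ ω, (∫ t, φ t * f (flow β ω t) * (starRingEnd ℂ) ((χ ω : Circle) : ℂ)) ∂μ := by
        simp only [GenDirichlet.groupFourier, flowConv, integral_mul_const]
    _ = ∫ t, ∫ ω, φ t * f (flow β ω t) * (starRingEnd ℂ) ((χ ω : Circle) : ℂ) ∂μ :=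
        (integral_integral_swap (f := fun t ω => φ t * f (flow β ω t) *
          (starRingEnd ℂ) ((χ ω : Circle) : ℂ)) hint).symm
    _ = ∫ t, GenDirichlet.groupFourier μ f χ *
          (φ t * ((χ (β (Multiplicative.ofAdd t)) : Circle) : ℂ)) := by
        congr 1
        ext t
        rw [GenDirichlet.groupFourier, ← integral_mul_right_eq_self
          (fun ω => f ω * (starRingEnd ℂ) ((χ ω : Circle) : ℂ)) (β (Multiplicative.ofAdd t)),
          ← integral_mul_const]
        congr 1
        ext ω
        set z := χ (β (Multiplicative.ofAdd t))
        have hz : (starRingEnd ℂ) (z : ℂ) * (z : ℂ) = 1 := by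
          rw [Complex.conj_mul', Circle.norm_coe]; simp
        rw [map_mul, Circle.coe_mul, map_mul, flow]
        linear_combination (-(φ t * f (ω * β (Multiplicative.ofAdd t)) *
          (starRingEnd ℂ) ((χ ω : Circle) : ℂ))) * hz
    _ = _ := integral_const_mul _ _

/-- Convolution along a one-parameter subgroup, as an operator on `L¹(G)`. -/
def flowConvL1 (β : Multiplicative ℝ →ₜ* G) {φ : ℝ → ℂ} (hφ : Integrable φ) :
    Lp ℂ 1 μ →L[ℂ] Lp ℂ 1 μ :=
  LinearMap.mkContinuous
    { toFun := fun f => (integrable_flowConv μ β (L1.integrable_coeFn f) hφ).toL1 _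
      map_add' := fun f g => by
        rw [← Integrable.toL1_add, Integrable.toL1_eq_toL1_iff]
        exact (flowConv_congr_ae μ β (Lp.coeFn_add f g) φ).trans
          (flowConv_add_ae μ β (L1.integrable_coeFn f) (L1.integrable_coeFn g) hφ)
      map_smul' := fun c f => by
        rw [RingHom.id_apply, ← Integrable.toL1_smul, Integrable.toL1_eq_toL1_iff]
        refine (flowConv_congr_ae μ β (Lp.coeFn_smul c f) φ).trans ?_
        rw [flowConv_smul]
        rfl } (∫ t, ‖φ t‖) (fun f => by
      have h := integral_norm_flowConv_le μ β (L1.integrable_coeFn f) hφ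
      rw [← L1.norm_eq_integral_norm] at h
      refine le_trans (le_of_eq ?_) h
      rw [L1.norm_eq_integral_norm]
      refine integral_congr_ae ?_
      filter_upwards [Integrable.coeFn_toL1
        (integrable_flowConv μ β (L1.integrable_coeFn f) hφ)] with ω hω
      exact congrArg _ hω)

theorem coeFn_flowConvL1 (β : Multiplicative ℝ →ₜ* G) {φ : ℝ → ℂ} (hφ : Integrable φ)
    (f : Lp ℂ 1 μ) : flowConvL1 μ β hφ f =ᵐ[μ] flowConv β f φ :=
  Integrable.coeFn_toL1 (integrable_flowConv μ β (L1.integrable_coeFn f) hφ)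

theorem norm_flowConvL1_apply_le (β : Multiplicative ℝ →ₜ* G) {φ : ℝ → ℂ} (hφ : Integrable φ)
    (f : Lp ℂ 1 μ) : ‖flowConvL1 μ β hφ f‖ ≤ (∫ t, ‖φ t‖) * ‖f‖ :=
  (LinearMap.mkContinuous_norm_le _ (integral_nonneg fun _ => norm_nonneg _) _).trans' le_rfl
    |> fun h => (ContinuousLinearMap.le_of_opNorm_le _ h f)

theorem flowConvL1_char [CompactSpace G] (β : Multiplicative ℝ →ₜ* G) {φ : ℝ → ℂ}
    (hφ : Integrable φ) (χ : PontryaginDual G) :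
    flowConvL1 μ β hφ (ContinuousMap.toLp 1 μ ℂ χ.toContinuousMap) =
      (∫ t, φ t * ((χ (β (Multiplicative.ofAdd t)) : Circle) : ℂ)) •
        (ContinuousMap.toLp 1 μ ℂ χ.toContinuousMap : Lp ℂ 1 μ) := by
  refine Lp.ext ?_
  have h := ContinuousMap.coeFn_toLp (p := 1) (𝕜 := ℂ) μ χ.toContinuousMap
  filter_upwards [coeFn_flowConvL1 μ β hφ (ContinuousMap.toLp 1 μ ℂ χ.toContinuousMap), h,
    flowConv_congr_ae μ β h φ, Lp.coeFn_smul
      (∫ t, φ t * ((χ (β (Multiplicative.ofAdd t)) : Circle) : ℂ))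
        (ContinuousMap.toLp 1 μ ℂ χ.toContinuousMap : Lp ℂ 1 μ)] with ω h1 h2 h3 h4
  rw [h1, h3, flowConv_char, h4, Pi.smul_apply, h2]
  rfl

end FlowConv

/-! ### Dilations and approximate identities -/

namespace GenDirichlet

theorem integrable_dilate {ψ : ℝ → ℂ} (hψ : Integrable ψ) {N : ℝ} (hN : 0 < N) :
    Integrable (dilate ψ N) :=
  (hψ.comp_mul_left' hN.ne').const_mul _

theorem integral_dilate_mul (ψ h : ℝ → ℂ) {N : ℝ} (hN : 0 < N) :
    ∫ t, dilate ψ N t * h t = ∫ t, ψ t * h (t / N) := by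
  have h1 := Measure.integral_comp_mul_left (fun t => ψ t * h (t / N)) N
  have h2 : ∀ t, dilate ψ N t * h t = N * (ψ (N * t) * h (N * t / N)) := fun t => by
    rw [mul_div_cancel_left₀ _ hN.ne', dilate, mul_assoc]
  simp only [h2]
  rw [integral_const_mul, h1, abs_of_pos (inv_pos.2 hN), Complex.real_smul, ← mul_assoc,
    ← Complex.ofReal_mul, mul_inv_cancel₀ hN.ne', Complex.ofReal_one, one_mul]

theorem integral_norm_dilate (ψ : ℝ → ℂ) {N : ℝ} (hN : 0 < N) :
    ∫ t, ‖dilate ψ N t‖ = ∫ t, ‖ψ t‖ := by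
  have h1 := Measure.integral_comp_mul_left (fun t => ‖ψ t‖) N
  simp only [dilate, norm_mul, Complex.norm_real, Real.norm_eq_abs, abs_of_pos hN]
  rw [integral_const_mul, h1, abs_of_pos (inv_pos.2 hN), smul_eq_mul, ← mul_assoc,
    mul_inv_cancel₀ hN.ne', one_mul]

theorem lineFourier_dilate (ψ : ℝ → ℂ) {N : ℝ} (hN : 0 < N) (ξ : ℝ) :
    lineFourier (dilate ψ N) ξ = lineFourier ψ (ξ / N) := by
  rw [lineFourier, integral_dilate_mul ψ (fun t => Complex.exp (-Complex.I * (t : ℂ) * (ξ : ℂ))) hN,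
    lineFourier]
  congr 1
  ext t
  push_cast
  congr 2
  ring

theorem norm_exp_neg_I_mul (t ξ : ℝ) : ‖Complex.exp (-Complex.I * (t : ℂ) * (ξ : ℂ))‖ = 1 := by
  rw [show -Complex.I * (t : ℂ) * (ξ : ℂ) = ((-(t * ξ) : ℝ) : ℂ) * Complex.I by push_cast; ring]
  exact Complex.norm_exp_ofReal_mul_I _

theorem continuous_lineFourier {ψ : ℝ → ℂ} (hψ : Integrable ψ) : Continuous (lineFourier ψ) := by
  refine continuous_of_dominated (bound := fun t => ‖ψ t‖) (fun ξ => ?_) (fun ξ => ?_) hψ.norm ?_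
  · exact hψ.aestronglyMeasurable.mul (by fun_prop)
  · refine Eventually.of_forall fun t => ?_
    rw [norm_mul, norm_exp_neg_I_mul, mul_one]
  · exact Eventually.of_forall fun t => by fun_prop

variable {G : Type*} [CommGroup G] [TopologicalSpace G] [IsTopologicalGroup G] [CompactSpace G]
    [T2Space G] [MeasurableSpace G] [BorelSpace G] (μ : Measure G) [μ.IsHaarMeasure]

/-- Characters are eigenvectors of these operators, with eigenvalues `∫ ψ(t) χ(β(t/N)) dt → ∫ ψ =
1`. They span a dense subspace of `L¹`, and the operators are uniformly bounded by `‖ψ‖₁`. -/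
theorem tendsto_flowConvL1_dilate (β : Multiplicative ℝ →ₜ* G) {ψ : ℝ → ℂ} (hψ : Integrable ψ)
    (hψ1 : ∫ t, ψ t = 1) (f : Lp ℂ 1 μ) :
    Tendsto (fun j : ℕ => flowConvL1 μ β (integrable_dilate hψ (Nat.cast_add_one_pos (α := ℝ) j)) f)
      atTop (𝓝 f) := by
  set T : ℕ → Lp ℂ 1 μ →L[ℂ] Lp ℂ 1 μ := fun j =>
    flowConvL1 μ β (integrable_dilate hψ (Nat.cast_add_one_pos (α := ℝ) j)) with hT
  have hchar : ∀ χ : PontryaginDual G, Tendsto (fun j : ℕ => ∫ t, dilate ψ ((j : ℝ) + 1) t *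
      ((χ (β (Multiplicative.ofAdd t)) : Circle) : ℂ)) atTop (𝓝 1) := by
    intro χ
    have hc : Continuous fun t : ℝ => ((χ (β (Multiplicative.ofAdd t)) : Circle) : ℂ) :=
      χ.toContinuousMap.continuous.comp ((map_continuous β).comp continuous_ofAdd)
    simp only [fun j : ℕ => integral_dilate_mul ψ
      (fun t => ((χ (β (Multiplicative.ofAdd t)) : Circle) : ℂ)) (Nat.cast_add_one_pos (α := ℝ) j)]
    rw [← hψ1]
    refine tendsto_integral_of_dominated_convergence (fun t => ‖ψ t‖) (fun j => ?_) hψ.norm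
      (fun j => Eventually.of_forall fun t => ?_) (Eventually.of_forall fun t => ?_)
    · exact hψ.aestronglyMeasurable.mul
        (hc.comp (continuous_id.div_const _)).aestronglyMeasurable
    · rw [norm_mul, Circle.norm_coe, mul_one]
    · have h0 : Tendsto (fun j : ℕ => t / ((j : ℝ) + 1)) atTop (𝓝 0) :=
        tendsto_const_nhds.div_atTop (tendsto_natCast_atTop_atTop.atTop_add tendsto_const_nhds)
      have h1 := (hc.tendsto 0).comp h0
      simpa using h1.const_mul (ψ t)
  let S : Submodule ℂ (Lp ℂ 1 μ) :=
    { carrier := {f | Tendsto (fun j => T j f) atTop (𝓝 f)}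
      add_mem' := fun {f g} hf hg => by
        simp only [Set.mem_ofPred_eq, map_add]
        exact Tendsto.add hf hg
      zero_mem' := by simp
      smul_mem' := fun c f hf => by
        simp only [Set.mem_ofPred_eq, map_smul]
        exact Tendsto.const_smul hf c }
  set B := ∫ t, ‖ψ t‖ with hB
  have hB0 : 0 ≤ B := integral_nonneg fun _ => norm_nonneg _
  have hTB : ∀ j f, ‖T j f‖ ≤ B * ‖f‖ := fun j f => by
    rw [hB, ← integral_norm_dilate ψ (Nat.cast_add_one_pos (α := ℝ) j)]
    exact norm_flowConvL1_apply_le μ β _ f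
  have hS : IsClosed (S : Set (Lp ℂ 1 μ)) := by
    refine isClosed_of_closure_subset fun f hf => ?_
    change Tendsto (fun j => T j f) atTop (𝓝 f)
    rw [Metric.tendsto_atTop]
    intro ε hε
    -- The two terms involving `f - g` cost `(B + 1)‖f - g‖ < ε/2` together; the `+ 1` also keeps
    -- the denominator positive.
    obtain ⟨g, hg, hfg⟩ := Metric.mem_closure_iff.1 hf (ε / (2 * (B + 1))) (by positivity)
    obtain ⟨m, hm⟩ := Metric.tendsto_atTop.1 (show Tendsto (fun j => T j g) atTop (𝓝 g) from hg)
      (ε / 2) (half_pos hε)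
    refine ⟨m, fun j hj => ?_⟩
    have h1 := hm j hj
    have h2 := hTB j (f - g)
    rw [dist_eq_norm] at h1 hfg ⊢
    rw [lt_div_iff₀ (by positivity)] at hfg
    have h3 : T j f - f = T j (f - g) + (T j g - g) - (f - g) := by rw [map_sub]; abel
    rw [h3]
    have h4 := norm_sub_le (T j (f - g) + (T j g - g)) (f - g)
    have h5 := norm_add_le (T j (f - g)) (T j g - g)
    nlinarith
  have hle : Submodule.span ℂ (Set.range fun χ : PontryaginDual G =>
      (ContinuousMap.toLp 1 μ ℂ χ.toContinuousMap : Lp ℂ 1 μ)) ≤ S := by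
    rw [Submodule.span_le]
    rintro _ ⟨χ, rfl⟩
    change Tendsto (fun j => T j _) atTop (𝓝 _)
    simp only [hT, flowConvL1_char]
    simpa using (hchar χ).smul_const (ContinuousMap.toLp 1 μ ℂ χ.toContinuousMap : Lp ℂ 1 μ)
  have hcl := Submodule.topologicalClosure_minimal _ hle hS
  rw [span_charL1_topologicalClosure_eq_top] at hcl
  exact hcl (Submodule.mem_top : f ∈ _)

theorem exists_lineFourier_eq_zero {ψ : ℝ → ℂ} (hψ : HasCompactSupport (lineFourier ψ)) :
    ∃ B, 0 ≤ B ∧ ∀ ξ, B < ξ → lineFourier ψ ξ = 0 := by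
  obtain ⟨B, hB⟩ := hψ.isCompact.bddAbove
  refine ⟨max B 0, le_max_right _ _, fun ξ hξ => image_eq_zero_of_notMem_tsupport fun h => ?_⟩
  exact absurd (hB h) (not_le.2 ((le_max_left _ _).trans_lt hξ))

/-- One truncation index serves all `N ≤ R`, because the support of `ψ̂(· / N)` is bounded above by
`B N ≤ B R` and the frequencies tend to infinity. -/
theorem exists_lineFourier_dilate_eq_zero {lam : ℕ → ℝ} (hlam : IsFrequency lam) {ψ : ℝ → ℂ}
    (hψ : HasCompactSupport (lineFourier ψ)) (R : ℝ) :
    ∃ m : ℕ, ∀ N, 0 < N → N ≤ R → ∀ n, m ≤ n → lineFourier (dilate ψ N) (lam n) = 0 := by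
  obtain ⟨B, hB0, hB⟩ := exists_lineFourier_eq_zero hψ
  obtain ⟨m, hm⟩ := eventually_atTop.1 (hlam.tendsto_atTop.eventually_gt_atTop (B * R))
  refine ⟨m, fun N hN hNR n hn => ?_⟩
  rw [lineFourier_dilate ψ hN]
  refine hB _ ((lt_div_iff₀ hN).2 ((mul_le_mul_of_nonneg_left hNR hB0).trans_lt (hm n hn)))

/-! ### The mollifier as a finite sum: sublinearity and measurability -/

section Sum

variable {G : Type*} [CommGroup G] [TopologicalSpace G] [MeasurableSpace G] {lam : ℕ → ℝ}
  (D : DirichletGroup lam G) (μ : Measure G)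

theorem mollify_eq_sum {φ : ℝ → ℂ} {m : ℕ} (hm : ∀ n, m ≤ n → lineFourier φ (lam n) = 0)
    (f : G → ℂ) (ω : G) :
    mollify D μ φ f ω = ∑ n ∈ Finset.range m,
      groupFourier μ f (D.char n) * lineFourier φ (lam n) * ((D.char n ω : Circle) : ℂ) := by
  refine tsum_eq_sum fun n hn => ?_
  rw [Finset.mem_range, not_lt] at hn
  rw [hm n hn, mul_zero, zero_mul]

variable (hlam : IsFrequency lam) {ψ : ℝ → ℂ} (hψ : HasCompactSupport (lineFourier ψ))

include hlam hψ

theorem mollify_dilate_add [BorelSpace G] {N : ℝ} (hN : 0 < N) (f g : Lp ℂ 1 μ) (ω : G) :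
    mollify D μ (dilate ψ N) (f + g : Lp ℂ 1 μ) ω =
      mollify D μ (dilate ψ N) f ω + mollify D μ (dilate ψ N) g ω := by
  obtain ⟨m, hm⟩ := exists_lineFourier_dilate_eq_zero hlam hψ N
  simp only [mollify_eq_sum D μ (hm N hN le_rfl), groupFourier_add, add_mul,
    Finset.sum_add_distrib]

theorem mollify_dilate_smul {N : ℝ} (hN : 0 < N) (c : ℂ) (f : Lp ℂ 1 μ) (ω : G) :
    mollify D μ (dilate ψ N) (c • f : Lp ℂ 1 μ) ω = c * mollify D μ (dilate ψ N) f ω := by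
  obtain ⟨m, hm⟩ := exists_lineFourier_dilate_eq_zero hlam hψ N
  simp only [mollify_eq_sum D μ (hm N hN le_rfl), groupFourier_smul, Finset.mul_sum, mul_assoc]

theorem continuous_mollify_dilate {N : ℝ} (hN : 0 < N) (f : G → ℂ) :
    Continuous (mollify D μ (dilate ψ N) f) := by
  obtain ⟨m, hm⟩ := exists_lineFourier_dilate_eq_zero hlam hψ N
  have : mollify D μ (dilate ψ N) f = fun ω => ∑ n ∈ Finset.range m,
      groupFourier μ f (D.char n) * lineFourier (dilate ψ N) (lam n) *
        (D.char n).toContinuousMap ω := by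
    ext ω
    exact mollify_eq_sum D μ (hm N hN le_rfl) f ω
  rw [this]
  fun_prop

theorem continuous_mollify_dilate_param (hψi : Integrable ψ) (f : G → ℂ) (ω : G) :
    Continuous fun N : Set.Ici (1 : ℝ) => mollify D μ (dilate ψ N) f ω := by
  rw [continuous_iff_continuousAt]
  intro N₀
  -- The margin `+ 1` makes the number of terms constant on a neighbourhood of `N₀`.
  obtain ⟨m, hm⟩ := exists_lineFourier_dilate_eq_zero hlam hψ (N₀ + 1)
  have hpos : ∀ N : Set.Ici (1 : ℝ), 0 < (N : ℝ) := fun N => one_pos.trans_le N.2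
  have hc : Continuous fun N : Set.Ici (1 : ℝ) => ∑ n ∈ Finset.range m,
      groupFourier μ f (D.char n) * lineFourier ψ (lam n / N) * ((D.char n ω : Circle) : ℂ) := by
    refine continuous_finsetSum _ fun n _ => ?_
    refine (continuous_const.mul ((continuous_lineFourier hψi).comp ?_)).mul continuous_const
    exact continuous_const.div continuous_subtype_val fun N => (hpos N).ne'
  refine hc.continuousAt.congr ?_
  have hev : ∀ᶠ N : Set.Ici (1 : ℝ) in 𝓝 N₀, (N : ℝ) < N₀ + 1 :=
    continuous_subtype_val.continuousAt.eventually_lt_const (lt_add_one _)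
  filter_upwards [hev] with N hN
  rw [mollify_eq_sum D μ (hm N (hpos N) hN.le)]
  simp only [lineFourier_dilate ψ (hpos N)]

/-- Continuity in `N` reduces the supremum to a countable one. This gives measurability, and later
lets almost everywhere identities valid for each single `N` be applied simultaneously. -/
theorem maximalMollify_eq_iSup_denseSeq (hψi : Integrable ψ) (f : G → ℂ) (ω : G) :
    maximalMollify D μ ψ f ω = ⨆ k : ℕ,
      ‖mollify D μ (dilate ψ (TopologicalSpace.denseSeq (Set.Ici (1 : ℝ)) k)) f ω‖ₑ := by
  refine le_antisymm (iSup_le fun N => ?_) (iSup_le fun k => le_iSup (fun N : Set.Ici (1 : ℝ) =>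
    ‖mollify D μ (dilate ψ N) f ω‖ₑ) _)
  refine (TopologicalSpace.denseRange_denseSeq (Set.Ici (1 : ℝ))).induction_on
    (p := fun N => ‖mollify D μ (dilate ψ N) f ω‖ₑ ≤ _) N ?_ fun k => ?_
  · exact isClosed_le (continuous_mollify_dilate_param D μ hlam hψ hψi f ω).enorm continuous_const
  · exact le_iSup (fun k : ℕ =>
      ‖mollify D μ (dilate ψ (TopologicalSpace.denseSeq (Set.Ici (1 : ℝ)) k)) f ω‖ₑ) k

theorem measurable_maximalMollify [BorelSpace G] (hψi : Integrable ψ) (f : G → ℂ) :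
    Measurable (maximalMollify D μ ψ f) := by
  have : maximalMollify D μ ψ f = fun ω => ⨆ k : ℕ,
      ‖mollify D μ (dilate ψ (TopologicalSpace.denseSeq (Set.Ici (1 : ℝ)) k)) f ω‖ₑ :=
    funext (maximalMollify_eq_iSup_denseSeq D μ hlam hψ hψi f)
  rw [this]
  exact Measurable.iSup fun k => (continuous_mollify_dilate D μ hlam hψ
    (one_pos.trans_le (TopologicalSpace.denseSeq (Set.Ici (1 : ℝ)) k).2) f).enorm.measurable

theorem maximalMollify_add_le [BorelSpace G] (f g : Lp ℂ 1 μ) (ω : G) :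
    maximalMollify D μ ψ (f + g : Lp ℂ 1 μ) ω ≤
      maximalMollify D μ ψ f ω + maximalMollify D μ ψ g ω := by
  refine iSup_le fun N => ?_
  rw [mollify_dilate_add D μ hlam hψ (one_pos.trans_le N.2)]
  exact (enorm_add_le _ _).trans (add_le_add
    (le_iSup (fun N : Set.Ici (1 : ℝ) => ‖mollify D μ (dilate ψ N) f ω‖ₑ) N)
    (le_iSup (fun N : Set.Ici (1 : ℝ) => ‖mollify D μ (dilate ψ N) g ω‖ₑ) N))

theorem maximalMollify_smul (c : ℂ) (f : Lp ℂ 1 μ) (ω : G) :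
    maximalMollify D μ ψ (c • f : Lp ℂ 1 μ) ω = ‖c‖ₑ * maximalMollify D μ ψ f ω := by
  rw [maximalMollify, maximalMollify, ENNReal.mul_iSup]
  refine iSup_congr fun N => ?_
  rw [mollify_dilate_smul D μ hlam hψ (one_pos.trans_le N.2), enorm_mul]

end Sum

/-! ### Domination by the maximal average -/

section Pointwise

/-- Pointwise domination of the convolution along the flow by the dyadic maximal average. -/
theorem enorm_flowConv_dilate_le {G : Type*} [CommGroup G] [TopologicalSpace G]
    [IsTopologicalGroup G] [MeasurableSpace G] [BorelSpace G] (β : Multiplicative ℝ →ₜ* G)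
    {f : G → ℂ} (hf : Measurable f) {ψ : ℝ → ℂ} {g : ℝ → ℝ} (hg : AntitoneOn g (Set.Ioi 0))
    (hgi : IntegrableOn g (Set.Ioi 0)) (hψg : ∀ x : ℝ, x ≠ 0 → ‖ψ x‖ ≤ g |x|) {N : ℝ}
    (hN : 0 < N) (ω : G) :
    ‖flowConv β f (dilate ψ N) ω‖ₑ ≤ 4 * (∫⁻ t in Set.Ioi 0, ENNReal.ofReal (g t)) *
      dyadicMax fun t => ‖f (flow β ω t)‖ₑ := by
  have hg0 : ∀ t ∈ Set.Ioi (0 : ℝ), 0 ≤ g t := fun t (ht : 0 < t) => by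
    have h := hψg t ht.ne'
    rw [abs_of_pos ht] at h
    exact (norm_nonneg _).trans h
  -- The dilated majorant `N g(N ·)` has the same integral as `g`, so the bound is uniform in `N`.
  have hscale : ∫⁻ t in Set.Ioi (0 : ℝ), ENNReal.ofReal (N * g (N * t)) =
      ∫⁻ t in Set.Ioi 0, ENNReal.ofReal (g t) := by
    have hi : IntegrableOn (fun t => N * g (N * t)) (Set.Ioi 0) := by
      refine Integrable.const_mul ?_ N
      exact (integrableOn_Ioi_comp_mul_left_iff g 0 hN).2 (by rwa [mul_zero])
    rw [← ofReal_integral_eq_lintegral_ofReal hi, ← ofReal_integral_eq_lintegral_ofReal hgi,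
      integral_const_mul, integral_comp_mul_left_Ioi g 0 hN, mul_zero, smul_eq_mul, ← mul_assoc,
      mul_inv_cancel₀ hN.ne', one_mul]
    · exact (ae_restrict_mem measurableSet_Ioi).mono hg0
    · refine (ae_restrict_mem measurableSet_Ioi).mono fun t ht => ?_
      exact mul_nonneg hN.le (hg0 _ (mul_pos hN ht))
  rw [← hscale]
  refine le_trans ?_ (lintegral_mul_radial_le (fun t => ‖f (flow β ω t)‖ₑ)
    (hf.comp (measurable_flow_right β ω)).enorm (fun t => ENNReal.ofReal (N * g (N * t))) ?_)
  · refine (enorm_integral_le_lintegral_enorm _).trans (lintegral_mono_ae ?_)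
    have h0 : ∀ᵐ t : ℝ, t ≠ 0 := by simp [ae_iff]
    filter_upwards [h0] with t ht
    rw [enorm_mul, mul_comm]
    refine mul_le_mul_right ?_ _
    rw [← ofReal_norm, dilate, norm_mul, Complex.norm_real, Real.norm_eq_abs, abs_of_pos hN]
    refine ENNReal.ofReal_le_ofReal (mul_le_mul_of_nonneg_left ?_ hN.le)
    have h := hψg (N * t) (mul_ne_zero hN.ne' ht)
    rwa [abs_mul, abs_of_pos hN] at h
  · intro a ha b hb hab
    refine ENNReal.ofReal_le_ofReal (mul_le_mul_of_nonneg_left ?_ hN.le)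
    exact hg (Set.mem_Ioi.2 (mul_pos hN ha)) (Set.mem_Ioi.2 (mul_pos hN hb))
      (mul_le_mul_of_nonneg_left hab hN.le)

end Pointwise

/-! ### Identification on the Hardy space and the weak type inequality -/

section Coefficients

variable {G : Type*} [CommGroup G] [TopologicalSpace G] {lam : ℕ → ℝ}

/-- At time `π / (λ_n - λ_k)` the two exponentials differ by the factor `-1`. -/
theorem DirichletGroup.char_injective (hlam : IsFrequency lam) (D : DirichletGroup lam G) :
    Function.Injective D.char := by
  intro n k hnk
  by_contra hne
  have hd : lam n - lam k ≠ 0 := sub_ne_zero.2 (hlam.strictMono.injective.ne hne)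
  have h1 := D.char_comp n (Real.pi / (lam n - lam k))
  rw [hnk, D.char_comp k, Complex.exp_eq_exp_iff_exp_sub_eq_one] at h1
  have hd' : (lam n : ℂ) - lam k ≠ 0 := by exact_mod_cast hd
  have h2 : -Complex.I * (lam k : ℂ) * ((Real.pi / (lam n - lam k) : ℝ) : ℂ) -
      -Complex.I * (lam n : ℂ) * ((Real.pi / (lam n - lam k) : ℝ) : ℂ) = Real.pi * Complex.I := by
    push_cast
    field_simp
    ring
  rw [h2, Complex.exp_pi_mul_I] at h1
  norm_num at h1

theorem DirichletGroup.integral_mul_char (D : DirichletGroup lam G) (φ : ℝ → ℂ) (n : ℕ) :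
    ∫ t, φ t * ((D.char n (D.β (Multiplicative.ofAdd t)) : Circle) : ℂ) =
      lineFourier φ (lam n) := by
  simp only [D.char_comp, lineFourier]
  congr 1
  ext t
  ring_nf

variable [IsTopologicalGroup G] [CompactSpace G] [T2Space G] [MeasurableSpace G] [BorelSpace G]
  (μ : Measure G) [μ.IsHaarMeasure] [IsProbabilityMeasure μ]

omit [CompactSpace G] [T2Space G] in
open Classical in
theorem groupFourier_char (χ χ' : PontryaginDual G) :
    groupFourier μ χ.toContinuousMap χ' = if χ = χ' then 1 else 0 := by
  have hconj : ∀ z : Circle, (z : ℂ) * (starRingEnd ℂ) (z : ℂ) = 1 := fun z => by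
    rw [Complex.mul_conj', Circle.norm_coe]; simp
  split_ifs with h
  · subst h
    simp [groupFourier, hconj]
  · obtain ⟨x, hx⟩ : ∃ x, χ x ≠ χ' x := by
      by_contra! h'
      exact h (PontryaginDual.ext h')
    set I := groupFourier μ χ.toContinuousMap χ' with hI
    have h1 : I = ((χ x : Circle) : ℂ) * (starRingEnd ℂ) ((χ' x : Circle) : ℂ) * I := by
      rw [hI, groupFourier, ← integral_const_mul,
        ← integral_mul_left_eq_self (fun ω => χ.toContinuousMap ω *
          (starRingEnd ℂ) ((χ' ω : Circle) : ℂ)) x]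
      congr 1
      ext ω
      simp only [PontryaginDual.toContinuousMap_apply, map_mul, Circle.coe_mul]
      ring
    by_contra hI0
    have h2 := mul_right_cancel₀ hI0 ((one_mul I).trans h1)
    refine hx (Circle.ext ?_)
    linear_combination (-((χ' x : Circle) : ℂ)) * h2 - ((χ x : Circle) : ℂ) * hconj (χ' x)

omit [T2Space G] in
open Classical in
theorem groupFourier_sum_char (D : DirichletGroup lam G) (a : ℕ → ℂ) (m : ℕ)
    (χ : PontryaginDual G) :
    groupFourier μ (fun ω => ∑ n ∈ Finset.range m, a n * ((D.char n ω : Circle) : ℂ)) χ =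
      ∑ n ∈ Finset.range m, a n * if D.char n = χ then 1 else 0 := by
  rw [groupFourier]
  simp only [Finset.sum_mul, mul_assoc]
  rw [integral_finsetSum]
  · refine Finset.sum_congr rfl fun n _ => ?_
    rw [integral_const_mul, ← groupFourier_char μ (D.char n) χ]
    rfl
  · intro n _
    refine Integrable.const_mul ?_ _
    have hc : Continuous fun ω => (D.char n).toContinuousMap ω *
        (starRingEnd ℂ) (χ.toContinuousMap ω) := by fun_prop
    exact hc.integrable_of_hasCompactSupport (HasCompactSupport.of_compactSpace _)

variable (hlam : IsFrequency lam) (D : DirichletGroup lam G) {ψ : ℝ → ℂ} (hψi : Integrable ψ)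
    (hψ : HasCompactSupport (lineFourier ψ))

include hlam hψi hψ

/-- On the Hardy space the mollification is the convolution along the flow. -/
theorem flowConv_ae_eq_mollify {f : Lp ℂ 1 μ} (hf : f ∈ hardyOne D μ) {N : ℝ} (hN : 0 < N) :
    flowConv D.β f (dilate ψ N) =ᵐ[μ] mollify D μ (dilate ψ N) f := by
  classical
  obtain ⟨m, hm⟩ := exists_lineFourier_dilate_eq_zero hlam hψ N
  have hm := hm N hN le_rfl
  have hφ := integrable_dilate hψi hN
  have h1 := integrable_flowConv μ D.β (L1.integrable_coeFn f) hφ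
  have hcont := continuous_mollify_dilate D μ hlam hψ hN f
  have h2 : Integrable (mollify D μ (dilate ψ N) f) μ :=
    hcont.integrable_of_hasCompactSupport (HasCompactSupport.of_compactSpace _)
  have h0 := ae_eq_zero_of_groupFourier_eq_zero μ
    (fun ω => flowConv D.β f (dilate ψ N) ω - mollify D μ (dilate ψ N) f ω) (h1.sub h2) ?_
  · filter_upwards [h0] with ω hω
    exact sub_eq_zero.1 hω
  intro χ
  have hχ : AEStronglyMeasurable (fun ω => (starRingEnd ℂ) ((χ ω : Circle) : ℂ)) μ :=
    (Complex.continuous_conj.comp χ.toContinuousMap.continuous).aestronglyMeasurable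
  have hχ1 : ∀ᵐ ω ∂μ, ‖(starRingEnd ℂ) ((χ ω : Circle) : ℂ)‖ ≤ 1 := Eventually.of_forall fun ω =>
    (RCLike.norm_conj ((χ ω : Circle) : ℂ)).trans_le (Circle.norm_coe _).le
  have hsub : groupFourier μ (fun ω => flowConv D.β f (dilate ψ N) ω -
      mollify D μ (dilate ψ N) f ω) χ = groupFourier μ (flowConv D.β f (dilate ψ N)) χ -
        groupFourier μ (mollify D μ (dilate ψ N) f) χ := by
    simp only [groupFourier, sub_mul]
    exact integral_sub (h1.mul_bdd hχ hχ1) (h2.mul_bdd hχ hχ1)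
  rw [hsub, groupFourier_flowConv μ D.β (L1.integrable_coeFn f) hφ,
    show mollify D μ (dilate ψ N) f = fun ω => ∑ n ∈ Finset.range m,
      groupFourier μ f (D.char n) * lineFourier (dilate ψ N) (lam n) *
        ((D.char n ω : Circle) : ℂ) from funext (mollify_eq_sum D μ hm f),
    groupFourier_sum_char, sub_eq_zero]
  -- At `h_{λ_k}` the finite sum returns its `k`-th coefficient, or zero when `k ≥ m`, where
  -- `ψ̂_N(λ_k)` vanishes too. Off the spectrum, membership in the Hardy space kills the convolution
  -- side.
  by_cases hχr : χ ∈ Set.range D.char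
  · obtain ⟨k, rfl⟩ := hχr
    simp only [(D.char_injective hlam).eq_iff, D.integral_mul_char, mul_ite, mul_one, mul_zero,
      Finset.sum_ite_eq', Finset.mem_range]
    split_ifs with hk
    · rfl
    · rw [hm k (not_lt.1 hk), mul_zero]
  · rw [hf χ hχr, zero_mul, Finset.sum_eq_zero]
    intro n _
    rw [if_neg fun h => hχr ⟨n, h⟩, mul_zero]

/-- The maximal function is dominated almost everywhere by the dyadic maximal average. -/
theorem maximalMollify_ae_le {g : ℝ → ℝ} (hg : AntitoneOn g (Set.Ioi 0))
    (hgi : IntegrableOn g (Set.Ioi 0)) (hψg : ∀ x : ℝ, x ≠ 0 → ‖ψ x‖ ≤ g |x|)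
    {f : Lp ℂ 1 μ} (hf : f ∈ hardyOne D μ) :
    ∀ᵐ ω ∂μ, maximalMollify D μ ψ f ω ≤ 4 * (∫⁻ t in Set.Ioi 0, ENNReal.ofReal (g t)) *
      dyadicMax fun t => ‖f (flow D.β ω t)‖ₑ := by
  have hpos : ∀ k, 0 < (TopologicalSpace.denseSeq (Set.Ici (1 : ℝ)) k : ℝ) := fun k =>
    one_pos.trans_le (TopologicalSpace.denseSeq (Set.Ici (1 : ℝ)) k).2
  have h := ae_all_iff.2 fun k => flowConv_ae_eq_mollify μ hlam D hψi hψ hf (hpos k)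
  filter_upwards [h] with ω hω
  rw [maximalMollify_eq_iSup_denseSeq D μ hlam hψ hψi]
  refine iSup_le fun k => ?_
  rw [← hω k]
  exact enorm_flowConv_dilate_le D.β (Lp.stronglyMeasurable f).measurable hg hgi hψg (hpos k) ω

/-- The weak type `(1, 1)` inequality for the maximal operator on the Hardy space. -/
theorem exists_weakL1Norm_maximalMollify_le {g : ℝ → ℝ} (hg : AntitoneOn g (Set.Ioi 0))
    (hgi : IntegrableOn g (Set.Ioi 0)) (hψg : ∀ x : ℝ, x ≠ 0 → ‖ψ x‖ ≤ g |x|) :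
    ∃ C : ℝ≥0, ∀ f ∈ hardyOne D μ, weakL1Norm μ (maximalMollify D μ ψ f) ≤ C * ‖f‖ₑ := by
  have hfin : ∫⁻ t in Set.Ioi 0, ENNReal.ofReal (g t) ≠ ⊤ :=
    (lt_of_le_of_lt (lintegral_mono fun t => Real.ofReal_le_enorm (g t)) hgi.2).ne
  set A := (∫⁻ t in Set.Ioi 0, ENNReal.ofReal (g t)).toNNReal
  have hA : (A : ℝ≥0∞) = _ := ENNReal.coe_toNNReal hfin
  -- The `+ 1` makes the constant nonzero, so that the level `t` can be divided by it.
  set C : ℝ≥0 := 4 * A + 1 with hC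
  have hC0 : (C : ℝ≥0∞) ≠ 0 := by
    rw [ENNReal.coe_ne_zero, hC]; positivity
  refine ⟨20 * C, fun f hf => iSup_le fun t => ?_⟩
  have hae := maximalMollify_ae_le μ hlam D hψi hψ hg hgi hψg hf
  have hsub : μ {ω | (t : ℝ≥0∞) < maximalMollify D μ ψ f ω} ≤
      μ {ω | (t / C : ℝ≥0∞) < dyadicMax fun u => ‖f (flow D.β ω u)‖ₑ} := by
    refine measure_mono_ae ?_
    filter_upwards [hae] with ω hω hlt
    change (t / C : ℝ≥0∞) < dyadicMax fun u => ‖f (flow D.β ω u)‖ₑ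
    rw [ENNReal.div_lt_iff (Or.inl hC0) (Or.inl ENNReal.coe_ne_top), mul_comm]
    refine (lt_of_lt_of_le hlt hω).trans_le ?_
    gcongr
    rw [← hA, hC]
    push_cast
    exact le_self_add
  have hweak := mul_measure_lt_dyadicMax_flow_le μ D.β
    (Lp.stronglyMeasurable f).measurable.enorm (t / C : ℝ≥0∞)
  have hnorm : ∫⁻ ω, ‖f ω‖ₑ ∂μ = ‖f‖ₑ := by
    rw [Lp.enorm_def, eLpNorm_one_eq_lintegral_enorm]
  rw [hnorm] at hweak
  calc (t : ℝ≥0∞) * μ {ω | (t : ℝ≥0∞) < maximalMollify D μ ψ f ω}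
      ≤ t * μ {ω | (t / C : ℝ≥0∞) < dyadicMax fun u => ‖f (flow D.β ω u)‖ₑ} := by gcongr
    _ = C * (t / C * μ {ω | (t / C : ℝ≥0∞) < dyadicMax fun u => ‖f (flow D.β ω u)‖ₑ}) := by
        rw [← mul_assoc, ENNReal.mul_div_cancel hC0 ENNReal.coe_ne_top]
    _ ≤ C * (20 * ‖f‖ₑ) := by gcongr
    _ = _ := by push_cast; ring

end Coefficients

/-! ### Almost everywhere convergence -/

section Convergence

variable {G : Type*} [CommGroup G] [TopologicalSpace G] {lam : ℕ → ℝ}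
  [IsTopologicalGroup G] [CompactSpace G] [T2Space G] [MeasurableSpace G] [BorelSpace G]
  (μ : Measure G) [μ.IsHaarMeasure] [IsProbabilityMeasure μ]

omit [CompactSpace G] [T2Space G] in
theorem groupFourier_flowConvL1 (β : Multiplicative ℝ →ₜ* G) {φ : ℝ → ℂ} (hφ : Integrable φ)
    (f : Lp ℂ 1 μ) (χ : PontryaginDual G) :
    groupFourier μ (flowConvL1 μ β hφ f) χ = groupFourier μ f χ *
      ∫ t, φ t * ((χ (β (Multiplicative.ofAdd t)) : Circle) : ℂ) := by
  rw [← groupFourier_flowConv μ β (L1.integrable_coeFn f) hφ]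
  refine integral_congr_ae ?_
  filter_upwards [coeFn_flowConvL1 μ β hφ f] with ω hω
  rw [hω]

variable (hlam : IsFrequency lam) (D : DirichletGroup lam G) {ψ : ℝ → ℂ} (hψi : Integrable ψ)
    (hψ : HasCompactSupport (lineFourier ψ))

omit [CompactSpace G] [T2Space G] in
theorem flowConvL1_mem_hardyOne {φ : ℝ → ℂ} (hφ : Integrable φ) {f : Lp ℂ 1 μ}
    (hf : f ∈ hardyOne D μ) : flowConvL1 μ D.β hφ f ∈ hardyOne D μ := fun χ hχ => by
  rw [groupFourier_flowConvL1, hf χ hχ, zero_mul]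

include hlam hψi hψ

/-- Almost everywhere convergence for band-limited functions. -/
theorem tendsto_mollify_flowConvL1 (hψ1 : ∫ x, ψ x = 1) {f : Lp ℂ 1 μ} (hf : f ∈ hardyOne D μ)
    {R : ℝ} (hR : 0 < R) : ∀ᵐ ω ∂μ,
      Tendsto (fun N => mollify D μ (dilate ψ N) (flowConvL1 μ D.β (integrable_dilate hψi hR) f) ω)
        atTop (𝓝 (flowConvL1 μ D.β (integrable_dilate hψi hR) f ω)) := by
  obtain ⟨m, hm⟩ := exists_lineFourier_dilate_eq_zero hlam hψ R
  have hm := hm R hR le_rfl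
  filter_upwards [coeFn_flowConvL1 μ D.β (integrable_dilate hψi hR) f,
    flowConv_ae_eq_mollify μ hlam D hψi hψ hf hR] with ω h1 h2
  rw [h1, h2, mollify_eq_sum D μ hm]
  -- The cutoff `m` comes from the fixed dilation `R`, so the number of terms does not depend on
  -- `N`, and the limit may be taken term by term with `ψ̂(λ_n / N) → ψ̂(0) = 1`.
  have hsum : ∀ᶠ N : ℝ in atTop, ∑ n ∈ Finset.range m, groupFourier μ f (D.char n) *
      lineFourier (dilate ψ R) (lam n) * lineFourier ψ (lam n / N) *
        ((D.char n ω : Circle) : ℂ) =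
      mollify D μ (dilate ψ N) (flowConvL1 μ D.β (integrable_dilate hψi hR) f) ω := by
    filter_upwards [eventually_gt_atTop 0] with N hN
    simp only [mollify, groupFourier_flowConvL1, D.integral_mul_char, lineFourier_dilate ψ hN]
    refine (tsum_eq_sum fun n hn => ?_).symm
    rw [Finset.mem_range, not_lt] at hn
    rw [hm n hn]
    ring
  refine Tendsto.congr' hsum (tendsto_finsetSum _ fun n _ => Tendsto.mul_const _ ?_)
  have h0 : lineFourier ψ 0 = 1 := by
    rw [← hψ1]
    simp [lineFourier]
  have h3 : Tendsto (fun N : ℝ => lam n / N) atTop (𝓝 0) := tendsto_const_nhds.div_atTop tendsto_id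
  have h4 := (((continuous_lineFourier hψi).tendsto 0).comp h3).const_mul
    (groupFourier μ f (D.char n) * lineFourier (dilate ψ R) (lam n))
  rwa [h0, mul_one] at h4

/-- The weak type inequality implies almost everywhere convergence. -/
theorem ae_tendsto_mollify (hψ1 : ∫ x, ψ x = 1) {C : ℝ≥0} (hC : ∀ f ∈ hardyOne D μ,
    weakL1Norm μ (maximalMollify D μ ψ f) ≤ C * ‖f‖ₑ) {f : Lp ℂ 1 μ} (hf : f ∈ hardyOne D μ) :
    ∀ᵐ ω ∂μ, Tendsto (fun N => mollify D μ (dilate ψ N) f ω) atTop (𝓝 (f ω)) := by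
  have key : ∀ ε : ℝ≥0, 0 < ε → ∀ᵐ ω ∂μ, ∀ᶠ N : ℝ in atTop,
      ‖mollify D μ (dilate ψ N) f ω - f ω‖ₑ ≤ 3 * ε := by
    intro ε hε
    set p : ℕ → Lp ℂ 1 μ := fun j =>
      flowConvL1 μ D.β (integrable_dilate hψi (Nat.cast_add_one_pos (α := ℝ) j)) f with hp
    set B := {ω | ¬ ∀ᶠ N : ℝ in atTop, ‖mollify D μ (dilate ψ N) f ω - f ω‖ₑ ≤ 3 * ε} with hB
    -- The three `ε` come from `R_{ψ_N}(f - p j)`, `R_{ψ_N}(p j) - p j` and `f - p j`. The middle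
    -- term is eventually small almost everywhere; the first is handled by the weak type bound
    -- (constant `C`) and the last by Markov's inequality (constant `1`).
    have hle : ∀ j, ε * μ B ≤ (C + 1) * ‖f - p j‖ₑ := by
      intro j
      have hmem : f - p j ∈ hardyOne D μ := Submodule.sub_mem _ hf
        (flowConvL1_mem_hardyOne μ D _ hf)
      have hconv := tendsto_mollify_flowConvL1 μ hlam D hψi hψ hψ1 hf
        (Nat.cast_add_one_pos (α := ℝ) j)
      have hsub : μ B ≤ μ ({ω | (ε : ℝ≥0∞) < maximalMollify D μ ψ (f - p j : Lp ℂ 1 μ) ω} ∪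
          {ω | (ε : ℝ≥0∞) ≤ ‖(f - p j : Lp ℂ 1 μ) ω‖ₑ}) := by
        refine measure_mono_ae ?_
        filter_upwards [hconv, Lp.coeFn_sub f (p j)] with ω h1 h2 hω
        by_contra hnot
        obtain ⟨h3, h4⟩ := not_or.1 hnot
        rw [Set.mem_ofPred_eq, not_lt] at h3
        rw [Set.mem_ofPred_eq, not_le] at h4
        refine hω ?_
        have h5 := (tendsto_iff_edist_tendsto_0.1 h1)
        rw [ENNReal.tendsto_nhds_zero] at h5
        filter_upwards [h5 ε (by exact_mod_cast hε), eventually_ge_atTop 1] with N h6 hN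
        have h7 := mollify_dilate_add D μ hlam hψ (one_pos.trans_le hN) (f - p j) (p j) ω
        rw [sub_add_cancel] at h7
        rw [Pi.sub_apply] at h2
        have h8 : mollify D μ (dilate ψ N) f ω - f ω =
            mollify D μ (dilate ψ N) (f - p j : Lp ℂ 1 μ) ω +
              (mollify D μ (dilate ψ N) (p j) ω - p j ω) - (f - p j : Lp ℂ 1 μ) ω := by
          rw [h7, h2]
          ring
        rw [h8]
        have h9 : ‖mollify D μ (dilate ψ N) (f - p j : Lp ℂ 1 μ) ω‖ₑ ≤ ε :=
          (le_iSup (fun N : Set.Ici (1 : ℝ) =>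
            ‖mollify D μ (dilate ψ N) (f - p j : Lp ℂ 1 μ) ω‖ₑ) ⟨N, hN⟩).trans h3
        rw [edist_eq_enorm_sub] at h6
        refine (enorm_sub_le).trans ((add_le_add (enorm_add_le _ _) h4.le).trans ?_)
        refine (add_le_add (add_le_add h9 h6) le_rfl).trans (le_of_eq ?_)
        ring
      have hw : (ε : ℝ≥0∞) * μ {ω | (ε : ℝ≥0∞) < maximalMollify D μ ψ (f - p j : Lp ℂ 1 μ) ω} ≤
          C * ‖f - p j‖ₑ :=
        (le_iSup (fun t : ℝ≥0 => (t : ℝ≥0∞) *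
          μ {ω | (t : ℝ≥0∞) < maximalMollify D μ ψ (f - p j : Lp ℂ 1 μ) ω}) ε).trans (hC _ hmem)
      have hm : (ε : ℝ≥0∞) * μ {ω | (ε : ℝ≥0∞) ≤ ‖(f - p j : Lp ℂ 1 μ) ω‖ₑ} ≤ ‖f - p j‖ₑ := by
        refine (mul_meas_ge_le_lintegral₀
          (Lp.stronglyMeasurable (f - p j)).measurable.enorm.aemeasurable _).trans (le_of_eq ?_)
        rw [Lp.enorm_def, eLpNorm_one_eq_lintegral_enorm]
      calc (ε : ℝ≥0∞) * μ B ≤ ε * (_ + _) := by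
            gcongr
            exact hsub.trans (measure_union_le _ _)
        _ ≤ C * ‖f - p j‖ₑ + ‖f - p j‖ₑ := by
            rw [mul_add]
            exact add_le_add hw hm
        _ = _ := by ring
    have hlim : Tendsto (fun j => ((C : ℝ≥0∞) + 1) * ‖f - p j‖ₑ) atTop (𝓝 0) := by
      have h1 : Tendsto (fun j => f - p j) atTop (𝓝 (f - f)) :=
        tendsto_const_nhds.sub (tendsto_flowConvL1_dilate μ D.β hψi hψ1 f)
      have h2 := (continuous_enorm.tendsto (f - f)).comp h1
      rw [sub_self, enorm_zero] at h2
      have h3 := ENNReal.Tendsto.const_mul (a := (C : ℝ≥0∞) + 1) h2 (Or.inr (by simp))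
      rwa [mul_zero] at h3
    have h0 : ε * μ B = 0 := le_antisymm (ge_of_tendsto' hlim hle) zero_le
    rw [mul_eq_zero] at h0
    exact h0.resolve_left (by exact_mod_cast hε.ne')
  -- Countably many tolerances `1/(k+1)` suffice, so their exceptional null sets can be united.
  have hall := ae_all_iff.2 fun k : ℕ => key ((k : ℝ≥0) + 1)⁻¹ (by positivity)
  filter_upwards [hall] with ω hω
  rw [tendsto_iff_edist_tendsto_0, ENNReal.tendsto_nhds_zero]
  intro ε hε
  obtain ⟨k, hk⟩ := ENNReal.exists_inv_nat_lt (ENNReal.div_pos hε.ne' (by simp : (3 : ℝ≥0∞) ≠ ⊤)).ne'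
  filter_upwards [hω k] with N hN
  rw [edist_eq_enorm_sub]
  refine hN.trans ?_
  rw [ENNReal.coe_inv (by positivity)]
  push_cast
  calc 3 * ((k : ℝ≥0∞) + 1)⁻¹ ≤ 3 * (ε / 3) := by
        gcongr
        exact (ENNReal.inv_le_inv.2 le_self_add).trans hk.le
    _ = ε := ENNReal.mul_div_cancel (by simp) (by simp)

end Convergence

end GenDirichlet
end

/-! ### The main theorem -/

theorem mainTheorem5 {lam : ℕ → ℝ} (hlam : GenDirichlet.IsFrequency lam)
    {G : Type*} [CommGroup G] [TopologicalSpace G] [IsTopologicalGroup G] [CompactSpace G]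
    [T2Space G] [MeasurableSpace G] [BorelSpace G]
    (μ : Measure G) [μ.IsHaarMeasure] [IsProbabilityMeasure μ]
    (D : GenDirichlet.DirichletGroup lam G)
    (ψ : ℝ → ℂ) (hψ_int : Integrable ψ volume)
    (hψ_cont : ∃ S : Set ℝ, S.Finite ∧ ∀ x, x ∉ S → ContinuousAt ψ x)
    (hψ_supp : HasCompactSupport (GenDirichlet.lineFourier ψ))
    (hψ_maj : ∃ g : ℝ → ℝ, AntitoneOn g (Set.Ioi 0) ∧ IntegrableOn g (Set.Ioi 0) volume ∧
      ∀ x : ℝ, x ≠ 0 → ‖ψ x‖ ≤ g |x|) :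
    ((∀ f ∈ GenDirichlet.hardyOne D μ, Measurable (GenDirichlet.maximalMollify D μ ψ f)) ∧
      (∀ f ∈ GenDirichlet.hardyOne D μ, ∀ g ∈ GenDirichlet.hardyOne D μ, ∀ ω : G,
        GenDirichlet.maximalMollify D μ ψ (f + g : Lp ℂ 1 μ) ω ≤
          GenDirichlet.maximalMollify D μ ψ f ω + GenDirichlet.maximalMollify D μ ψ g ω) ∧
      (∀ c : ℂ, ∀ f ∈ GenDirichlet.hardyOne D μ, ∀ ω : G,
        GenDirichlet.maximalMollify D μ ψ (c • f : Lp ℂ 1 μ) ω =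
          ‖c‖ₑ * GenDirichlet.maximalMollify D μ ψ f ω) ∧
      (∃ C : ℝ≥0, ∀ f ∈ GenDirichlet.hardyOne D μ,
        GenDirichlet.weakL1Norm μ (GenDirichlet.maximalMollify D μ ψ f) ≤ C * ‖f‖ₑ)) ∧
    ((∫ x, ψ x) = 1 → ∀ f ∈ GenDirichlet.hardyOne D μ, ∀ᵐ ω ∂μ,
      Tendsto (fun N : ℝ => GenDirichlet.mollify D μ (GenDirichlet.dilate ψ N) f ω) atTop
        (𝓝 (f ω))) := by
  obtain ⟨g, hg, hgi, hψg⟩ := hψ_maj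
  have hweak := GenDirichlet.exists_weakL1Norm_maximalMollify_le μ hlam D hψ_int hψ_supp
    hg hgi hψg
  refine ⟨⟨fun f _ => GenDirichlet.measurable_maximalMollify D μ hlam hψ_supp hψ_int f,
    fun f _ g _ => GenDirichlet.maximalMollify_add_le D μ hlam hψ_supp f g,
    fun c f _ => GenDirichlet.maximalMollify_smul D μ hlam hψ_supp c f, hweak⟩,
    fun hψ1 f hf => ?_⟩
  obtain ⟨C, hC⟩ := hweak
  exact GenDirichlet.ae_tendsto_mollify μ hlam D hψ_int hψ_supp hψ1 hC hf
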